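/- Let $S^1=\mathbb{R}/\mathbb{Z}$. For a smooth zero-mean function $v$ on $S^1$, an integer $m\ge 0$ and $p\in[1,\infty]$, put $|v|_{m,p}=\|d^m v/dx^m\|_{L_p(S^1)}$, $|v|_p=|v|_{0,p}$ and $\gamma=\gamma(m,p)=\max(0,m-1/p)$ (with $1/\infty=0$). Let $f\in C^\infty(\mathbb{R})$ satisfy $f''\ge\sigma$ on $\mathbb{R}$ for some $\sigma>0$, and let $D>0$. For $\nu\in(0,1]$, let $\mathcal{S}_\nu$ be the set of all smooth solutions $u$ on $[0,\infty)\times S^1$ of $$u_t+f'(u)u_x-\nu u_{xx}=0$$ whose initial value $u_0=u(0,\cdot)$ has zero mean, is not identically zero, and satisfies $\max(|u_0|_1^{-1},|u_0|_{1,\infty})=D$. Then the following hold. (0) There is a constant $\tilde C>0$, depending only on $f$ and $D$, such that $|u(t)|_{1,2}^2\le\tilde C\nu^{-1}$ for all $\nu\in(0,1]$, $u\in\mathcal{S}_\nu$ and $t\ge0$. (1) (Pointwise upper bounds.) If $m\in\{0,1\}$ and $p\in[1,\infty]$, or $m\ge2$ and $p\in(1,\infty]$, then there is a constant $C>0$,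 depending only on $f,\sigma,D,m,p$, such that $$|u(t)|_{m,p}\le C\max(\nu^{-\gamma},t^{-\gamma})\qquad\text{for all }\nu\in(0,1],\ u\in\mathcal{S}_\nu,\ t>0.$$ Now fix any $\tilde C>0$ as in (0), set $$T_1=\tfrac14D^{-2}\tilde C^{-1},\qquad T_2=\max\bigl(\tfrac32T_1,\,2D\sigma^{-1}\bigr),$$ and write $\{A(t)\}=\frac1{T_2-T_1}\int_{T_1}^{T_2}A(t)\,dt$. (2) (Two-sided bounds.) If $m\in\{0,1\}$ and $p\in[1,\infty]$, or $m\ge2$ and $p\in(1,\infty]$, then for every $\alpha>0$ there is a constant $C>0$, depending only on $f,\sigma,D,\tilde C,m,p,\alpha$, such that $$C^{-1}\nu^{-\gamma}\le\bigl(\{|u(t)|_{m,p}^\alpha\}\bigr)^{1/\alpha}\le C\nu^{-\gamma}\qquad\text{for all }\nu\in(0,1],\ u\in\mathcal{S}_\nu.$$ (3) (Lower bounds.) For every $m\ge0$, $p\in[1,\infty]$ and $\alpha>0$ there is a constant $c>0$, depending only on $f,\sigma,D,\tilde C,m,p,\alpha$, such that $$\bigl(\{|u(t)|_{m,p}^\alpha\}\bigr)^{1/\alpha}\ge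 c\,\nu^{-\gamma}\qquad\text{for all }\nu\in(0,1],\ u\in\mathcal{S}_\nu.$$ -/

import Mathlib

open MeasureTheory Set
open scoped ENNReal ContDiff

noncomputable section

/-- The homogeneous norm `|v|_{m,p}`, that is, the `L_p` norm over one period of the `m`-th
derivative of a (smooth) `1`-periodic function `v`; the value is in `[0, ∞]`. -/
def sobolevNorm (m : ℕ) (p : ℝ≥0∞) (v : ℝ → ℝ) : ℝ≥0∞ :=
  eLpNorm (iteratedDeriv m v) p (volume.restrict (Ioc (0 : ℝ) 1))

/-- The exponent `γ(m,p) = max(0, m - 1/p)`, with `1/∞ = 0`. -/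
def gammaExp (m : ℕ) (p : ℝ≥0∞) : ℝ :=
  max 0 ((m : ℝ) - (p⁻¹).toReal)

/-- `u` is a smooth solution on `[0,∞) × S¹` (functions on `S¹ = ℝ/ℤ` being `1`-periodic functions
on `ℝ`) of `u_t + f'(u) u_x - ν u_xx = 0`, with zero-mean initial value.
The values `u t x` for `t < 0` play no role. -/
structure IsBurgersSolution (f : ℝ → ℝ) (ν : ℝ) (u : ℝ → ℝ → ℝ) : Prop where
  smooth : ContDiffOn ℝ ∞ (fun z : ℝ × ℝ => u z.1 z.2) (Ici 0 ×ˢ univ)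
  periodic : ∀ t, 0 ≤ t → Function.Periodic (u t) 1
  mean_zero : ∫ x in (0 : ℝ)..1, u 0 x = 0
  equation : ∀ t, 0 < t → ∀ x,
    deriv (fun s => u s x) t + deriv f (u t x) * deriv (u t) x
      - ν * iteratedDeriv 2 (u t) x = 0

/-- `max(|u₀|_1⁻¹, |u₀|_{1,∞})`, a value in `[0, ∞]`; it is `∞` for `u₀ = 0`. -/
def initialParam (u₀ : ℝ → ℝ) : ℝ≥0∞ :=
  max (sobolevNorm 0 1 u₀)⁻¹ (sobolevNorm 1 ∞ u₀)

/-- `K` bounds `ν |u(t)|_{1,2}²` for all `t ≥ 0`, all `ν ∈ (0,1]` and all solutions `u` whose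
initial value has parameter `D`. -/
def IsH1Constant (f : ℝ → ℝ) (D K : ℝ) : Prop :=
  ∀ ν : ℝ, 0 < ν → ν ≤ 1 → ∀ u : ℝ → ℝ → ℝ, IsBurgersSolution f ν u →
    initialParam (u 0) = ENNReal.ofReal D →
      ∀ t : ℝ, 0 ≤ t → sobolevNorm 1 2 (u t) ^ 2 ≤ ENNReal.ofReal (K * ν⁻¹)

/-- The left end of the averaging interval, `T₁ = D⁻² K⁻¹ / 4`. -/
def timeOne (D K : ℝ) : ℝ := 1 / 4 * (D ^ 2)⁻¹ * K⁻¹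

/-- The right end of the averaging interval, `T₂ = max(3 T₁ / 2, 2 D σ⁻¹)`. -/
def timeTwo (σ D K : ℝ) : ℝ := max (3 / 2 * timeOne D K) (2 * D * σ⁻¹)

/-- The time average `{A(t)} = (T₂ - T₁)⁻¹ ∫_{T₁}^{T₂} A(t) dt` of a `[0,∞]`-valued function. -/
def timeAverage (σ D K : ℝ) (A : ℝ → ℝ≥0∞) : ℝ≥0∞ :=
  (∫⁻ t in Icc (timeOne D K) (timeTwo σ D K), A t)
    / ENNReal.ofReal (timeTwo σ D K - timeOne D K)

/-- The averaged quantity `({|u(t)|_{m,p}^α})^{1/α}`. -/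
def averagedNorm (σ D K : ℝ) (m : ℕ) (p : ℝ≥0∞) (α : ℝ) (u : ℝ → ℝ → ℝ) : ℝ≥0∞ :=
  timeAverage σ D K (fun t => sobolevNorm m p (u t) ^ α) ^ (1 / α)

end

open MeasureTheory Set
open scoped ENNReal ContDiff

/-! ### Regularity of slices of functions on a half-plane -/

/-! Solutions vary on the length scale `ν`: they have bounded total variation and slopes at most of
order `1/ν`. The upper bounds express this, and the lower bounds follow by playing them against
energy dissipation.

Upper bounds come from the maximum principle. It gives `|u| ≤ D`, `u_x ≤ D` (by convexity of `f`)
and Oleinik's `t u_x ≤ 1/σ`; since `u_x` has mean zero, its one-sided bound also bounds `|u|_{1,1}`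
by `2D`. The function `f(u) - ν u_x` solves a linear drift-diffusion equation, so it stays below its
initial maximum, whence `|u_x| ≤ B/ν`. Bernstein's method (`exists_derivative_bound`) upgrades this
to `|∂^j u(t)| ≤ (B/h)^j` for every `h ≤ ν` and `t ≥ h`. For `m = 1`, interpolation between `L^1`
and `L^∞` gives the exponent `γ`. For `m ≥ 2` the matching `L^1` bound on `∂^m u` is not used:
finite differences express `∂^m u` through translates of `u_x`, up to a remainder of high order, and
Markov's inequality yields a distribution estimate decaying like `s^(-1-β)` with `β` as small as
desired. This suffices exactly for `p > 1` (`exists_eLpNorm_iteratedDeriv_bound`). The scale `h` is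
left free: `min ν t` serves for pointwise bounds, a fixed multiple of `ν` for averages.

Lower bounds start from the energy identity. The choice of `T₁` keeps at least half of the energy
`D⁻²` at time `T₁`, while Oleinik's estimate leaves at most a quarter of it at `T₂`. So `ν
|u|_{1,2}²` has integral bounded below on `[T₁, T₂]`; being at most `K`, it is bounded below on a
set of times of fixed measure. At such times Hölder's inequality against the upper bounds for `u_x`
bounds `|u|_{1,p}` below, and an induction climbs to higher orders
(`exists_lower_bound_of_le_integral_sq`): a large supremum of `v = ∂^m u`, which vanishes somewhere,
forces `∫ v² |v'|` to be large, and the upper bounds on `v` then force `v'` to be large in every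
`L^p`. -/

theorem uniqueDiffOn_halfPlane : UniqueDiffOn ℝ (Ici (0 : ℝ) ×ˢ (univ : Set ℝ)) :=
  (uniqueDiffOn_Ici 0).prod uniqueDiffOn_univ

theorem hasDerivAt_slice {F : ℝ → ℝ → ℝ}
    (hF : ContDiffOn ℝ ∞ (fun z : ℝ × ℝ => F z.1 z.2) (Ici 0 ×ˢ univ)) {t : ℝ} (ht : 0 ≤ t)
    (x : ℝ) :
    HasDerivAt (F t)
      (fderivWithin ℝ (fun z : ℝ × ℝ => F z.1 z.2) (Ici 0 ×ˢ univ) (t, x) (0, 1)) x := by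
  have h1 : HasFDerivWithinAt (fun z : ℝ × ℝ => F z.1 z.2)
      (fderivWithin ℝ (fun z : ℝ × ℝ => F z.1 z.2) (Ici 0 ×ˢ univ) (t, x)) (Ici 0 ×ˢ univ) (t, x) :=
    ((hF (t, x) ⟨ht, mem_univ _⟩).differentiableWithinAt (by simp)).hasFDerivWithinAt
  have h2 : HasDerivWithinAt (fun y : ℝ => (t, y)) ((0 : ℝ), (1 : ℝ)) univ x :=
    ((hasDerivAt_const x t).prodMk (hasDerivAt_id x)).hasDerivWithinAt
  have h3 := h1.comp_hasDerivWithinAt x h2 (fun y _ => ⟨ht, mem_univ _⟩)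
  exact hasDerivWithinAt_univ.1 h3

theorem contDiffOn_deriv_slice {F : ℝ → ℝ → ℝ}
    (hF : ContDiffOn ℝ ∞ (fun z : ℝ × ℝ => F z.1 z.2) (Ici 0 ×ˢ univ)) :
    ContDiffOn ℝ ∞ (fun z : ℝ × ℝ => deriv (F z.1) z.2) (Ici 0 ×ˢ univ) := by
  have h := (hF.fderivWithin (m := ∞) uniqueDiffOn_halfPlane (by simp)).clm_apply
    (contDiffOn_const (c := ((0 : ℝ), (1 : ℝ))))
  refine h.congr fun z hz => ?_
  exact (hasDerivAt_slice hF hz.1 z.2).deriv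

theorem contDiffOn_iteratedDeriv_slice {F : ℝ → ℝ → ℝ}
    (hF : ContDiffOn ℝ ∞ (fun z : ℝ × ℝ => F z.1 z.2) (Ici 0 ×ˢ univ)) (m : ℕ) :
    ContDiffOn ℝ ∞ (fun z : ℝ × ℝ => iteratedDeriv m (F z.1) z.2) (Ici 0 ×ˢ univ) := by
  induction m with
  | zero => simpa using hF
  | succ m ih => simpa only [iteratedDeriv_succ] using contDiffOn_deriv_slice (F := fun t => iteratedDeriv m (F t)) ih

theorem contDiff_slice {F : ℝ → ℝ → ℝ}
    (hF : ContDiffOn ℝ ∞ (fun z : ℝ × ℝ => F z.1 z.2) (Ici 0 ×ˢ univ)) {t : ℝ} (ht : 0 ≤ t) :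
    ContDiff ℝ ∞ (F t) := by
  rw [← contDiffOn_univ]
  exact hF.comp (g := fun z : ℝ × ℝ => F z.1 z.2) (f := fun y : ℝ => (t, y))
    (contDiff_const.prodMk contDiff_id).contDiffOn (fun y _ => ⟨ht, mem_univ _⟩)

theorem hasDerivAt_iteratedDeriv {f : ℝ → ℝ} (hf : ContDiff ℝ ∞ f) (m : ℕ) (x : ℝ) :
    HasDerivAt (iteratedDeriv m f) (iteratedDeriv (m + 1) f x) x := by
  rw [iteratedDeriv_succ]
  exact ((hf.differentiable_iteratedDeriv m (by exact_mod_cast WithTop.coe_lt_top _)) x).hasDerivAt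

theorem contDiff_iteratedDeriv {f : ℝ → ℝ} (hf : ContDiff ℝ ∞ f) (m : ℕ) :
    ContDiff ℝ ∞ (iteratedDeriv m f) := by
  induction m with
  | zero => simpa using hf
  | succ m ih =>
    rw [iteratedDeriv_succ]
    exact ((contDiff_infty_iff_deriv).1 ih).2

theorem periodic_iteratedDeriv {f : ℝ → ℝ} (hf : Function.Periodic f 1) (m : ℕ) :
    Function.Periodic (iteratedDeriv m f) 1 := by
  intro x
  have h := iteratedDeriv_comp_add_const m f 1
  have h2 : (fun z => f (z + 1)) = f := funext hf
  rw [h2] at h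
  exact (congrFun h x).symm

/-- Mixed partial derivatives of a smooth function on the open half-plane commute. -/
theorem hasDerivAt_time_deriv_slice {F : ℝ → ℝ → ℝ}
    (hF : ContDiffOn ℝ ∞ (fun z : ℝ × ℝ => F z.1 z.2) (Ici 0 ×ˢ univ)) {t : ℝ} (ht : 0 < t)
    (x : ℝ) :
    HasDerivAt (fun s => deriv (F s) x) (deriv (fun y => deriv (fun s => F s y) t) x) t := by
  set G : ℝ × ℝ → ℝ := fun z : ℝ × ℝ => F z.1 z.2 with hG
  have hopen : ∀ s y : ℝ, 0 < s → (Ici (0 : ℝ) ×ˢ (univ : Set ℝ)) ∈ nhds (s, y) := fun s y hs =>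
    prod_mem_nhds (Ici_mem_nhds hs) Filter.univ_mem
  have hat : ∀ s y : ℝ, 0 < s → ContDiffAt ℝ ∞ G (s, y) := fun s y hs =>
    hF.contDiffAt (hopen s y hs)
  have hfd : ∀ s y : ℝ, 0 < s → HasFDerivAt G (fderiv ℝ G (s, y)) (s, y) := fun s y hs =>
    ((hat s y hs).differentiableAt (by simp)).hasFDerivAt
  have hsp : ∀ s y : ℝ, 0 < s → HasDerivAt (F s) (fderiv ℝ G (s, y) (0, 1)) y := fun s y hs =>
    (hfd s y hs).comp_hasDerivAt (f := fun y : ℝ => (s, y)) y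
      ((hasDerivAt_const y s).prodMk (hasDerivAt_id y))
  have hti : ∀ s y : ℝ, 0 < s → HasDerivAt (fun s => F s y) (fderiv ℝ G (s, y) (1, 0)) s :=
    fun s y hs => (hfd s y hs).comp_hasDerivAt (f := fun s : ℝ => (s, y)) s
      ((hasDerivAt_id s).prodMk (hasDerivAt_const s y))
  have h2 : HasFDerivAt (fderiv ℝ G) (fderiv ℝ (fderiv ℝ G) (t, x)) (t, x) :=
    (((hat t x ht).fderiv_right (m := 1) (by norm_cast)).differentiableAt (by simp)).hasFDerivAt
  have hsym : fderiv ℝ (fderiv ℝ G) (t, x) (1, 0) (0, 1) =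
      fderiv ℝ (fderiv ℝ G) (t, x) (0, 1) (1, 0) :=
    second_derivative_symmetric_of_eventually (f := G) (f' := fderiv ℝ G)
      (Filter.eventually_of_mem ((isOpen_Ioi.prod isOpen_univ).mem_nhds
        (show (t, x) ∈ Ioi (0 : ℝ) ×ˢ (univ : Set ℝ) from ⟨ht, mem_univ _⟩))
        (fun z hz => hfd z.1 z.2 hz.1)) h2 _ _
  have hA : HasDerivAt (fun s => fderiv ℝ G (s, x) (0, 1))
      (fderiv ℝ (fderiv ℝ G) (t, x) (1, 0) (0, 1)) t := by
    have := h2.comp_hasDerivAt (f := fun s : ℝ => (s, x)) t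
      ((hasDerivAt_id t).prodMk (hasDerivAt_const t x))
    exact ((ContinuousLinearMap.apply ℝ ℝ ((0 : ℝ), (1 : ℝ))).hasFDerivAt.comp_hasDerivAt t this)
  have hB : HasDerivAt (fun y => fderiv ℝ G (t, y) (1, 0))
      (fderiv ℝ (fderiv ℝ G) (t, x) (0, 1) (1, 0)) x := by
    have := h2.comp_hasDerivAt (f := fun y : ℝ => (t, y)) x
      ((hasDerivAt_const x t).prodMk (hasDerivAt_id x))
    exact ((ContinuousLinearMap.apply ℝ ℝ ((1 : ℝ), (0 : ℝ))).hasFDerivAt.comp_hasDerivAt x this)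
  have hB' : (fun y => deriv (fun s => F s y) t) = fun y => fderiv ℝ G (t, y) (1, 0) :=
    funext fun y => (hti t y ht).deriv
  rw [hB', hB.deriv, ← hsym]
  refine hA.congr_of_eventuallyEq ?_
  filter_upwards [lt_mem_nhds ht] with s hs using (hsp s x hs).deriv

theorem hasDerivAt_time_iteratedDeriv_slice {F : ℝ → ℝ → ℝ}
    (hF : ContDiffOn ℝ ∞ (fun z : ℝ × ℝ => F z.1 z.2) (Ici 0 ×ˢ univ)) {t : ℝ} (ht : 0 < t)
    (m : ℕ) (x : ℝ) :
    HasDerivAt (fun s => iteratedDeriv m (F s) x)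
      (iteratedDeriv m (fun y => deriv (fun s => F s y) t) x) t := by
  induction m generalizing x with
  | zero =>
    simp only [iteratedDeriv_zero]
    have h : ContDiffAt ℝ ∞ (fun z : ℝ × ℝ => F z.1 z.2) (t, x) :=
      hF.contDiffAt (prod_mem_nhds (Ici_mem_nhds ht) Filter.univ_mem)
    have h2 : DifferentiableAt ℝ (fun s => F s x) t :=
      (h.differentiableAt (by simp)).comp (f := fun s : ℝ => (s, x)) t
        (differentiableAt_id.prodMk (differentiableAt_const x))
    exact h2.hasDerivAt
  | succ m ih =>
    have h := hasDerivAt_time_deriv_slice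
      (F := fun t => iteratedDeriv m (F t)) (contDiffOn_iteratedDeriv_slice hF m) ht x
    simp only [iteratedDeriv_succ]
    have h3 : (fun y => deriv (fun s => iteratedDeriv m (F s) y) t) =
        iteratedDeriv m (fun y => deriv (fun s => F s y) t) := funext fun y => (ih y).deriv
    rwa [h3] at h

/-! ### A maximum principle for periodic functions -/

/-- With a positive second derivative the point would also be a local minimum, so the function would
be locally constant and its second derivative zero. -/
theorem nonpos_of_isLocalMax_of_hasDerivAt {f f' : ℝ → ℝ} {x d : ℝ} (hmax : IsLocalMax f x)
    (hf : ∀ y, HasDerivAt f (f' y) y) (hf' : HasDerivAt f' d x) : d ≤ 0 := by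
  by_contra! hd
  have hdf : deriv f = f' := funext fun y => (hf y).deriv
  have hmin : IsLocalMin f x := by
    refine isLocalMin_of_deriv_deriv_pos ?_ ?_ (hf x).continuousAt
    · rw [hdf, hf'.deriv]; exact hd
    · exact hmax.deriv_eq_zero
  have hconst : f =ᶠ[nhds x] fun _ => f x := by
    filter_upwards [hmax, hmin] with y h1 h2 using le_antisymm h1 h2
  have h1 : deriv f =ᶠ[nhds x] fun _ => 0 := by
    have := hconst.deriv
    simpa using this
  rw [hdf] at h1
  have h2 := h1.deriv_eq
  rw [hf'.deriv] at h2
  simp at h2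
  exact hd.ne' h2

/-- Subtracting the barrier with an extra slope `ε` makes the time derivative strictly negative at a
positive space-time maximum, so slightly earlier values would be larger. Periodicity supplies
compactness. The bound on the time derivative is demanded only at maxima lying above the barrier,
which Oleinik's estimate needs. -/
theorem periodic_le_add_mul_of_isLocalMax {φ : ℝ → ℝ → ℝ} {a b S M : ℝ}
    (hcont : ContinuousOn (fun z : ℝ × ℝ => φ z.1 z.2) (Icc a b ×ˢ univ))
    (hper : ∀ t ∈ Icc a b, Function.Periodic (φ t) 1)
    (hinit : ∀ x, φ a x ≤ S)
    (hmax : ∀ t ∈ Ioc a b, ∀ x, IsLocalMax (φ t) x → S + M * (t - a) < φ t x →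
      ∃ d ≤ M, HasDerivAt (fun s => φ s x) d t)
    {t : ℝ} (ht : t ∈ Icc a b) (x : ℝ) : φ t x ≤ S + M * (t - a) := by
  suffices h : ∀ ε > 0, φ t x ≤ S + M * (t - a) + ε * (t - a) by
    refine le_of_forall_pos_le_add fun ε hε => ?_
    have h1 := h (ε / (t - a + 1)) (div_pos hε (by linarith [ht.1]))
    have h2 : ε / (t - a + 1) * (t - a) ≤ ε := by
      rw [div_mul_eq_mul_div, div_le_iff₀ (by linarith [ht.1])]
      nlinarith [ht.1]
    linarith
  intro ε hε
  set ψ : ℝ × ℝ → ℝ := fun z => φ z.1 z.2 - (S + M * (z.1 - a) + ε * (z.1 - a)) with hψ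
  have hψc : ContinuousOn ψ (Icc a b ×ˢ Icc (0 : ℝ) 1) := by
    refine (hcont.mono (prod_mono le_rfl (subset_univ _))).sub ?_
    exact Continuous.continuousOn (by fun_prop)
  have hfr : ∀ y : ℝ, Int.fract y ∈ Icc (0 : ℝ) 1 := fun y =>
    ⟨Int.fract_nonneg y, (Int.fract_lt_one y).le⟩
  have hperfr : ∀ s ∈ Icc a b, ∀ y, φ s (Int.fract y) = φ s y := fun s hs y => by
    have := (hper s hs).sub_int_mul_eq (x := y) ⌊y⌋
    rwa [mul_one] at this
  obtain ⟨⟨t₀, x₀⟩, hz, hzmax⟩ := (isCompact_Icc.prod isCompact_Icc).exists_isMaxOn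
    (⟨(t, Int.fract x), ht, hfr x⟩ : (Icc a b ×ˢ Icc (0 : ℝ) 1).Nonempty) hψc
  have hall : ∀ s ∈ Icc a b, ∀ y, ψ (s, y) ≤ ψ (t₀, x₀) := fun s hs y => by
    have := hzmax (show (s, Int.fract y) ∈ Icc a b ×ˢ Icc (0 : ℝ) 1 from ⟨hs, hfr y⟩)
    simp only [hψ, mem_ofPred_eq, hperfr s hs] at this ⊢
    exact this
  suffices hle : ψ (t₀, x₀) ≤ 0 by
    have := (hall t ht x).trans hle
    simp only [hψ] at this
    linarith
  by_contra! hpos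
  have hz1 : t₀ ∈ Icc a b := hz.1
  rcases hz1.1.eq_or_lt with h0 | h0
  · have := hinit x₀
    simp only [hψ, ← h0] at hpos
    nlinarith
  have hlm : IsLocalMax (φ t₀) x₀ := Filter.Eventually.of_forall fun y => by
    have := hall t₀ hz1 y
    simp only [hψ] at this
    linarith
  have hval : S + M * (t₀ - a) < φ t₀ x₀ := by
    simp only [hψ] at hpos
    nlinarith
  obtain ⟨d, hd, hder⟩ := hmax t₀ ⟨h0, hz1.2⟩ x₀ hlm hval
  have hder2 : HasDerivAt (fun s => ψ (s, x₀)) (d - (M + ε)) t₀ := by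
    have e1 : HasDerivAt (fun s : ℝ => S + M * (s - a) + ε * (s - a)) (M + ε) t₀ := by
      have h1 := (hasDerivAt_id t₀).sub_const a
      exact (((h1.const_mul M).const_add S).add (h1.const_mul ε)).congr_deriv (by ring)
    exact hder.sub e1
  have hneg : d - (M + ε) < 0 := by linarith
  have hev : ∀ᶠ s in nhdsWithin t₀ (Iio t₀), ψ (t₀, x₀) < ψ (s, x₀) := by
    have h1 := (hasDerivAt_iff_tendsto_slope_left_right.1 hder2).1
    filter_upwards [h1 (Iio_mem_nhds hneg), self_mem_nhdsWithin] with s hs hs2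
    have hs3 : s < t₀ := hs2
    simp only [mem_preimage, slope_def_field, mem_Iio] at hs
    rw [div_lt_iff_of_neg (by linarith)] at hs
    linarith
  obtain ⟨s, hs, hs2⟩ := (hev.and (Ioo_mem_nhdsLT h0)).exists
  exact absurd (hall s ⟨hs2.1.le, hs2.2.le.trans hz1.2⟩ x₀) (not_le.2 hs)

/-! ### Comparison for drift-diffusion equations and integration in time -/

theorem le_add_mul_of_drift_diffusion {φ φ₁ φ₂ φt : ℝ → ℝ → ℝ} {a b S M : ℝ}
    (hcont : ContinuousOn (fun z : ℝ × ℝ => φ z.1 z.2) (Icc a b ×ˢ univ))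
    (hper : ∀ t ∈ Icc a b, Function.Periodic (φ t) 1)
    (hinit : ∀ x, φ a x ≤ S)
    (h1 : ∀ t ∈ Ioc a b, ∀ x, HasDerivAt (φ t) (φ₁ t x) x)
    (h2 : ∀ t ∈ Ioc a b, ∀ x, HasDerivAt (φ₁ t) (φ₂ t x) x)
    (h3 : ∀ t ∈ Ioc a b, ∀ x, HasDerivAt (fun s => φ s x) (φt t x) t)
    (h4 : ∀ t ∈ Ioc a b, ∀ x, S + M * (t - a) < φ t x → φ₁ t x = 0 → φ₂ t x ≤ 0 → φt t x ≤ M)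
    {t : ℝ} (ht : t ∈ Icc a b) (x : ℝ) : φ t x ≤ S + M * (t - a) := by
  refine periodic_le_add_mul_of_isLocalMax hcont hper hinit (fun t ht x hmax hlt => ?_) ht x
  refine ⟨φt t x, h4 t ht x hlt ?_ ?_, h3 t ht x⟩
  · rw [← (h1 t ht x).deriv]; exact hmax.deriv_eq_zero
  · exact nonpos_of_isLocalMax_of_hasDerivAt hmax (h1 t ht) (h2 t ht x)

theorem integral_eq_zero_of_hasDerivAt_periodic {P P' : ℝ → ℝ} (hP : Function.Periodic P 1)
    (hd : ∀ x, HasDerivAt P (P' x) x) (hc : Continuous P') : ∫ x in (0 : ℝ)..1, P' x = 0 := by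
  rw [intervalIntegral.integral_eq_sub_of_hasDerivAt (fun x _ => hd x) (hc.intervalIntegrable _ _)]
  have := hP 0
  simp only [zero_add] at this
  rw [this, sub_self]

/-- Freezing the time variable at `0` for negative times makes the integrand globally continuous, so
that continuity of parametric integrals applies up to `t = 0`. -/
theorem continuous_clamp {Q : ℝ → ℝ → ℝ}
    (hQ : ContinuousOn (fun z : ℝ × ℝ => Q z.1 z.2) (Ici 0 ×ˢ univ)) :
    Continuous (fun z : ℝ × ℝ => Q (max z.1 0) z.2) := by
  rw [← continuousOn_univ]
  refine hQ.comp (f := fun z : ℝ × ℝ => (max z.1 0, z.2)) (Continuous.continuousOn (by fun_prop)) ?_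
  exact fun z _ => ⟨mem_Ici.2 (le_max_right z.1 0), mem_univ _⟩

theorem continuousOn_integral_slice {Q : ℝ → ℝ → ℝ}
    (hQ : ContinuousOn (fun z : ℝ × ℝ => Q z.1 z.2) (Ici 0 ×ˢ univ)) :
    ContinuousOn (fun t => ∫ x in (0 : ℝ)..1, Q t x) (Ici 0) := by
  have h := intervalIntegral.continuous_parametric_intervalIntegral_of_continuous' (μ := volume)
    (f := fun t x => Q (max t 0) x) (continuous_clamp hQ) 0 1
  refine h.continuousOn.congr fun t ht => ?_
  simp only [max_eq_left (show (0 : ℝ) ≤ t from ht)]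

theorem integral_sub_integral_eq {E Q : ℝ → ℝ → ℝ}
    (hE : ContinuousOn (fun z : ℝ × ℝ => E z.1 z.2) (Ici 0 ×ˢ univ))
    (hQ : ContinuousOn (fun z : ℝ × ℝ => Q z.1 z.2) (Ici 0 ×ˢ univ))
    (hd : ∀ t, 0 < t → ∀ x, HasDerivAt (fun s => E s x) (Q t x) t) {a b : ℝ} (ha : 0 ≤ a)
    (hab : a ≤ b) :
    (∫ x in (0 : ℝ)..1, E b x) - ∫ x in (0 : ℝ)..1, E a x =
      ∫ t in a..b, ∫ x in (0 : ℝ)..1, Q t x := by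
  have hslice : ∀ {R : ℝ → ℝ → ℝ}, ContinuousOn (fun z : ℝ × ℝ => R z.1 z.2) (Ici 0 ×ˢ univ) →
      ∀ t, 0 ≤ t → Continuous (R t) := fun {R} hR t ht => by
    have := (continuous_clamp hR).comp (Continuous.prodMk_right t)
    simpa only [Function.comp_def, max_eq_left ht] using this
  have hQx : ∀ x, ContinuousOn (fun t => Q t x) (Icc a b) := fun x =>
    hQ.comp (f := fun t : ℝ => (t, x)) (by fun_prop) (fun t ht => ⟨ha.trans ht.1, mem_univ _⟩)
  have hEx : ∀ x, ContinuousOn (fun t => E t x) (Icc a b) := fun x =>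
    hE.comp (f := fun t : ℝ => (t, x)) (by fun_prop) (fun t ht => ⟨ha.trans ht.1, mem_univ _⟩)
  have hftc : ∀ x, ∫ t in a..b, Q t x = E b x - E a x := fun x =>
    intervalIntegral.integral_eq_sub_of_hasDerivAt_of_le hab (hEx x)
      (fun t ht => hd t (ha.trans_lt ht.1) x)
      (ContinuousOn.intervalIntegrable (by rw [uIcc_of_le hab]; exact hQx x))
  rw [← intervalIntegral.integral_sub ((hslice hE b (ha.trans hab)).intervalIntegrable _ _)
    ((hslice hE a ha).intervalIntegrable _ _)]
  simp_rw [← hftc]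
  refine intervalIntegral_intervalIntegral_swap ?_
  have hint : IntegrableOn (fun z : ℝ × ℝ => Q z.2 z.1) (Icc (0 : ℝ) 1 ×ˢ Icc a b) := by
    refine ContinuousOn.integrableOn_compact (isCompact_Icc.prod isCompact_Icc) ?_
    exact hQ.comp (f := fun z : ℝ × ℝ => (z.2, z.1)) (by fun_prop)
      (fun z hz => ⟨ha.trans hz.2.1, mem_univ _⟩)
  refine hint.mono_set ?_
  rw [uIoc_of_le hab, uIoc_of_le zero_le_one]
  exact prod_mono Ioc_subset_Icc_self Ioc_subset_Icc_self

/-! ### Basic properties of solutions -/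

namespace IsBurgersSolution

variable {f : ℝ → ℝ} {ν : ℝ} {u : ℝ → ℝ → ℝ}

theorem continuousOn_iteratedDeriv (hu : IsBurgersSolution f ν u) (m : ℕ) :
    ContinuousOn (fun z : ℝ × ℝ => iteratedDeriv m (u z.1) z.2) (Ici 0 ×ˢ univ) :=
  (contDiffOn_iteratedDeriv_slice hu.smooth m).continuousOn

theorem contDiff (hu : IsBurgersSolution f ν u) {t : ℝ} (ht : 0 ≤ t) : ContDiff ℝ ∞ (u t) :=
  contDiff_slice hu.smooth ht

theorem hasDerivAt (hu : IsBurgersSolution f ν u) {t : ℝ} (ht : 0 ≤ t) (m : ℕ) (x : ℝ) :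
    HasDerivAt (iteratedDeriv m (u t)) (iteratedDeriv (m + 1) (u t) x) x :=
  hasDerivAt_iteratedDeriv (hu.contDiff ht) m x

theorem hasDerivAt_zero (hu : IsBurgersSolution f ν u) {t : ℝ} (ht : 0 ≤ t) (x : ℝ) :
    HasDerivAt (u t) (iteratedDeriv 1 (u t) x) x := by
  simpa using hu.hasDerivAt ht 0 x

theorem continuous_iteratedDeriv (hu : IsBurgersSolution f ν u) {t : ℝ} (ht : 0 ≤ t) (m : ℕ) :
    Continuous (iteratedDeriv m (u t)) :=
  (contDiff_iteratedDeriv (hu.contDiff ht) m).continuous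

theorem periodic_deriv (hu : IsBurgersSolution f ν u) {t : ℝ} (ht : 0 ≤ t) (m : ℕ) :
    Function.Periodic (iteratedDeriv m (u t)) 1 :=
  periodic_iteratedDeriv (hu.periodic t ht) m

theorem hasDerivAt_flux (hu : IsBurgersSolution f ν u) (hf : ContDiff ℝ ∞ f) {t : ℝ} (ht : 0 ≤ t)
    (x : ℝ) : HasDerivAt (fun y => deriv f (u t y))
      (iteratedDeriv 2 f (u t x) * iteratedDeriv 1 (u t) x) x := by
  have h := (hasDerivAt_iteratedDeriv hf 1 (u t x)).comp x (hu.hasDerivAt_zero ht x)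
  simpa only [iteratedDeriv_one, Function.comp_def] using h

theorem contDiff_flux (hu : IsBurgersSolution f ν u) (hf : ContDiff ℝ ∞ f) {t : ℝ} (ht : 0 ≤ t) :
    ContDiff ℝ ∞ (fun y => deriv f (u t y)) := by
  have h := (contDiff_iteratedDeriv hf 1).comp (hu.contDiff ht)
  simpa only [iteratedDeriv_one, Function.comp_def] using h

theorem hasDerivAt_time (hu : IsBurgersSolution f ν u) (hf : ContDiff ℝ ∞ f) {t : ℝ} (ht : 0 < t)
    (m : ℕ) (x : ℝ) :
    HasDerivAt (fun s => iteratedDeriv m (u s) x)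
      (ν * iteratedDeriv (m + 2) (u t) x
        - iteratedDeriv m (fun y => deriv f (u t y) * iteratedDeriv 1 (u t) y) x) t := by
  refine (hasDerivAt_time_iteratedDeriv_slice hu.smooth ht m x).congr_deriv ?_
  have h : (fun y => deriv (fun s => u s y) t) = fun y =>
      ν * iteratedDeriv 2 (u t) y - deriv f (u t y) * iteratedDeriv 1 (u t) y := funext fun y => by
    have := hu.equation t ht y
    rw [iteratedDeriv_one]
    linarith
  have hc2 : ContDiff ℝ ∞ (iteratedDeriv 2 (u t)) := contDiff_iteratedDeriv (hu.contDiff ht.le) 2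
  have hc1 : ContDiff ℝ ∞ (iteratedDeriv 1 (u t)) := contDiff_iteratedDeriv (hu.contDiff ht.le) 1
  have hA : ContDiffAt ℝ m (fun y => ν * iteratedDeriv 2 (u t) y) x :=
    ((contDiff_const.mul hc2).of_le (by exact_mod_cast le_top)).contDiffAt
  have hB : ContDiffAt ℝ m (fun y => deriv f (u t y) * iteratedDeriv 1 (u t) y) x :=
    (((hu.contDiff_flux hf ht.le).mul hc1).of_le (by exact_mod_cast le_top)).contDiffAt
  rw [h, iteratedDeriv_fun_sub hA hB, iteratedDeriv_const_mul_field]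
  congr 2
  rw [iteratedDeriv_eq_iterate, iteratedDeriv_eq_iterate, iteratedDeriv_eq_iterate,
    ← Function.iterate_add_apply]

theorem hasDerivAt_time_zero (hu : IsBurgersSolution f ν u) (hf : ContDiff ℝ ∞ f) {t : ℝ}
    (ht : 0 < t) (x : ℝ) :
    HasDerivAt (fun s => u s x)
      (ν * iteratedDeriv 2 (u t) x - deriv f (u t x) * iteratedDeriv 1 (u t) x) t := by
  simpa using hu.hasDerivAt_time hf ht 0 x

theorem hasDerivAt_time_one (hu : IsBurgersSolution f ν u) (hf : ContDiff ℝ ∞ f) {t : ℝ}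
    (ht : 0 < t) (x : ℝ) :
    HasDerivAt (fun s => iteratedDeriv 1 (u s) x)
      (ν * iteratedDeriv 3 (u t) x - (iteratedDeriv 2 f (u t x) * iteratedDeriv 1 (u t) x ^ 2
        + deriv f (u t x) * iteratedDeriv 2 (u t) x)) t := by
  refine (hu.hasDerivAt_time hf ht 1 x).congr_deriv ?_
  congr 1
  rw [iteratedDeriv_one]
  refine (((hu.hasDerivAt_flux hf ht.le x).mul (hu.hasDerivAt ht.le 1 x)).congr_deriv ?_).deriv
  ring

theorem abs_le_of_initial (hu : IsBurgersSolution f ν u) (hf : ContDiff ℝ ∞ f) (hν : 0 < ν)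
    {D : ℝ} (hD : ∀ x, |u 0 x| ≤ D) {t : ℝ} (ht : 0 ≤ t) (x : ℝ) : |u t x| ≤ D := by
  have key : ∀ c : ℝ, |c| = 1 → c * u t x ≤ D := fun c hc => by
    have h := le_add_mul_of_drift_diffusion (a := 0) (b := t) (S := D) (M := 0)
      (φ := fun s y => c * u s y) (φ₁ := fun s y => c * iteratedDeriv 1 (u s) y)
      (φ₂ := fun s y => c * iteratedDeriv 2 (u s) y)
      (φt := fun s y => c * (ν * iteratedDeriv 2 (u s) y
        - deriv f (u s y) * iteratedDeriv 1 (u s) y))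
      (continuousOn_const.mul (hu.smooth.continuousOn.mono (prod_mono Icc_subset_Ici_self le_rfl)))
      (fun s hs y => by simp only [hu.periodic s hs.1 y])
      (fun y => (le_abs_self _).trans (by rw [abs_mul, hc, one_mul]; exact hD y))
      (fun s hs y => (hu.hasDerivAt_zero hs.1.le y).const_mul c)
      (fun s hs y => (hu.hasDerivAt hs.1.le 1 y).const_mul c)
      (fun s hs y => (hu.hasDerivAt_time_zero hf hs.1 y).const_mul c)
      (fun s hs y _ h1 h2 => by
        have : c * (ν * iteratedDeriv 2 (u s) y - deriv f (u s y) * iteratedDeriv 1 (u s) y) =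
          ν * (c * iteratedDeriv 2 (u s) y)
            - deriv f (u s y) * (c * iteratedDeriv 1 (u s) y) := by ring
        rw [this, h1]
        nlinarith) (t := t) ⟨ht, le_rfl⟩ x
    simpa using h
  have h1 := key 1 (by simp)
  have h2 := key (-1) (by simp)
  exact abs_le.2 ⟨by linarith, by linarith⟩

/-- At a maximum of `u_x` the transport term vanishes and the remaining term `-f''(u) u_x²` has a
sign. The sign is favourable only for bounds from above. -/
theorem deriv_le_of_initial (hu : IsBurgersSolution f ν u) (hf : ContDiff ℝ ∞ f) (hν : 0 < ν)
    (hconv : ∀ x, 0 ≤ iteratedDeriv 2 f x)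
    {D : ℝ} (hD : ∀ x, iteratedDeriv 1 (u 0) x ≤ D) {t : ℝ} (ht : 0 ≤ t) (x : ℝ) :
    iteratedDeriv 1 (u t) x ≤ D := by
  have h := le_add_mul_of_drift_diffusion (a := 0) (b := t) (S := D) (M := 0)
    (φ := fun s y => iteratedDeriv 1 (u s) y) (φ₁ := fun s y => iteratedDeriv 2 (u s) y)
    (φ₂ := fun s y => iteratedDeriv 3 (u s) y) (φt := _)
    ((hu.continuousOn_iteratedDeriv 1).mono (prod_mono Icc_subset_Ici_self le_rfl))
    (fun s hs => hu.periodic_deriv hs.1 1) hD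
    (fun s hs y => hu.hasDerivAt hs.1.le 1 y)
    (fun s hs y => hu.hasDerivAt hs.1.le 2 y)
    (fun s hs y => hu.hasDerivAt_time_one hf hs.1 y)
    (fun s hs y _ h1 h2 => by
      rw [h1]
      nlinarith [mul_nonneg (hconv (u s y)) (sq_nonneg (iteratedDeriv 1 (u s) y))])
    (t := t) ⟨ht, le_rfl⟩ x
  simpa using h

/-- The one-sided Lipschitz (Oleinik) estimate. -/
theorem mul_deriv_le (hu : IsBurgersSolution f ν u) (hf : ContDiff ℝ ∞ f) (hν : 0 < ν)
    {σ : ℝ} (hσ : 0 < σ) (hconv : ∀ x, σ ≤ iteratedDeriv 2 f x) {t : ℝ} (ht : 0 ≤ t) (x : ℝ) :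
    t * iteratedDeriv 1 (u t) x ≤ σ⁻¹ := by
  have h := le_add_mul_of_drift_diffusion (a := 0) (b := t) (S := σ⁻¹) (M := 0)
    (φ := fun s y => s * iteratedDeriv 1 (u s) y) (φ₁ := fun s y => s * iteratedDeriv 2 (u s) y)
    (φ₂ := fun s y => s * iteratedDeriv 3 (u s) y) (φt := _)
    (continuousOn_fst.mul
      ((hu.continuousOn_iteratedDeriv 1).mono (prod_mono Icc_subset_Ici_self le_rfl)))
    (fun s hs y => by simp only [hu.periodic_deriv hs.1 1 y])
    (fun y => by simpa using hσ.le)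
    (fun s hs y => (hu.hasDerivAt hs.1.le 1 y).const_mul s)
    (fun s hs y => (hu.hasDerivAt hs.1.le 2 y).const_mul s)
    (fun s hs y => (hasDerivAt_id s).mul (hu.hasDerivAt_time_one hf hs.1 y))
    (fun s hs y h0 h1 h2 => by
      have hs0 : 0 < s := hs.1
      rw [zero_mul, add_zero] at h0
      have e1 : iteratedDeriv 2 (u s) y = 0 := (mul_eq_zero.1 h1).resolve_left hs0.ne'
      have hpos : 0 < iteratedDeriv 1 (u s) y := by
        have : 0 < s * iteratedDeriv 1 (u s) y := (inv_pos.2 hσ).trans h0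
        exact (mul_pos_iff_of_pos_left hs0).1 this
      have h5 : 1 < σ * (s * iteratedDeriv 1 (u s) y) := by
        rwa [inv_lt_iff_one_lt_mul₀' hσ] at h0
      have h6 : σ * (s * iteratedDeriv 1 (u s) y) ≤
          iteratedDeriv 2 f (u s y) * (s * iteratedDeriv 1 (u s) y) :=
        mul_le_mul_of_nonneg_right (hconv _) (by positivity)
      simp only [id, e1]
      -- Where `s u_x` exceeds `1/σ`, the time derivative of `s u_x` is at most `u_x (1 - f''(u) s
      -- u_x)`, which is negative.
      nlinarith [mul_pos hpos (sub_pos.2 (h5.trans_le h6))])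
    (t := t) ⟨ht, le_rfl⟩ x
  simpa using h

/-- The quantity `f(u) - ν u_x` satisfies a linear drift-diffusion equation. -/
theorem flux_sub_le (hu : IsBurgersSolution f ν u) (hf : ContDiff ℝ ∞ f) (hν : 0 < ν)
    {Z : ℝ} (hZ : ∀ x, f (u 0 x) - ν * iteratedDeriv 1 (u 0) x ≤ Z) {t : ℝ} (ht : 0 ≤ t) (x : ℝ) :
    f (u t x) - ν * iteratedDeriv 1 (u t) x ≤ Z := by
  have hfd : ∀ y, HasDerivAt f (deriv f y) y := fun y => by
    simpa [iteratedDeriv_one] using hasDerivAt_iteratedDeriv hf 0 y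
  have h := le_add_mul_of_drift_diffusion (a := 0) (b := t) (S := Z) (M := 0)
    (φ := fun s y => f (u s y) - ν * iteratedDeriv 1 (u s) y)
    (φ₁ := fun s y => deriv f (u s y) * iteratedDeriv 1 (u s) y - ν * iteratedDeriv 2 (u s) y)
    (φ₂ := fun s y => (iteratedDeriv 2 f (u s y) * iteratedDeriv 1 (u s) y)
      * iteratedDeriv 1 (u s) y + deriv f (u s y) * iteratedDeriv 2 (u s) y
      - ν * iteratedDeriv 3 (u s) y) (φt := _)
    ((hf.continuous.comp_continuousOn
        (hu.smooth.continuousOn.mono (prod_mono Icc_subset_Ici_self le_rfl))).sub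
      (continuousOn_const.mul
      ((hu.continuousOn_iteratedDeriv 1).mono (prod_mono Icc_subset_Ici_self le_rfl))))
    (fun s hs y => by simp only [hu.periodic_deriv hs.1 1 y, hu.periodic s hs.1 y]) hZ
    (fun s hs y => ((hfd _).comp y (hu.hasDerivAt_zero hs.1.le y)).sub
      ((hu.hasDerivAt hs.1.le 1 y).const_mul ν))
    (fun s hs y => ((hu.hasDerivAt_flux hf hs.1.le y).mul (hu.hasDerivAt hs.1.le 1 y)).sub
      ((hu.hasDerivAt hs.1.le 2 y).const_mul ν))
    (fun s hs y => ((hfd (u s y)).comp s (hu.hasDerivAt_time_zero hf hs.1 y)).sub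
      ((hu.hasDerivAt_time_one hf hs.1 y).const_mul ν))
    (fun s hs y _ h1 h2 => by
      generalize deriv f (u s y) = g at *
      generalize iteratedDeriv 2 f (u s y) = g' at *
      generalize iteratedDeriv 1 (u s) y = a at *
      generalize iteratedDeriv 2 (u s) y = b at *
      generalize iteratedDeriv 3 (u s) y = c at *
      -- The identity says `φ_t = ν φ_xx - f'(u) φ_x` for `φ = f(u) - ν u_x`; the quadratic terms in
      -- `u_x` cancel.
      have : g * (ν * b - g * a) - ν * (ν * c - (g' * a ^ 2 + g * b)) =
        ν * (g' * a * a + g * b - ν * c) - g * (g * a - ν * b) := by ring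
      rw [this, h1]
      nlinarith)
    (t := t) ⟨ht, le_rfl⟩ x
  simpa using h

theorem continuousOn_time_deriv (hu : IsBurgersSolution f ν u) (hf : ContDiff ℝ ∞ f) :
    ContinuousOn (fun z : ℝ × ℝ => ν * iteratedDeriv 2 (u z.1) z.2
      - deriv f (u z.1 z.2) * iteratedDeriv 1 (u z.1) z.2) (Ici 0 ×ˢ univ) := by
  refine (continuousOn_const.mul (hu.continuousOn_iteratedDeriv 2)).sub
    (ContinuousOn.mul ?_ (hu.continuousOn_iteratedDeriv 1))
  have h : Continuous (deriv f) := by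
    simpa only [iteratedDeriv_one] using (contDiff_iteratedDeriv hf 1).continuous
  exact h.comp_continuousOn hu.smooth.continuousOn

theorem integral_eq_zero (hu : IsBurgersSolution f ν u) (hf : ContDiff ℝ ∞ f) {t : ℝ}
    (ht : 0 ≤ t) : ∫ x in (0 : ℝ)..1, u t x = 0 := by
  have hfd : ∀ y, HasDerivAt f (deriv f y) y := fun y => by
    simpa [iteratedDeriv_one] using hasDerivAt_iteratedDeriv hf 0 y
  have h := integral_sub_integral_eq (E := u) (Q := fun t x => ν * iteratedDeriv 2 (u t) x
    - deriv f (u t x) * iteratedDeriv 1 (u t) x) hu.smooth.continuousOn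
    (hu.continuousOn_time_deriv hf) (fun s hs y => hu.hasDerivAt_time_zero hf hs y) le_rfl ht
  rw [hu.mean_zero, sub_zero] at h
  rw [h]
  refine intervalIntegral.integral_zero_ae (Filter.Eventually.of_forall fun s hs => ?_)
  rw [uIoc_of_le ht] at hs
  refine integral_eq_zero_of_hasDerivAt_periodic
    (P := fun y => ν * iteratedDeriv 1 (u s) y - f (u s y))
    (fun y => by simp only [hu.periodic_deriv hs.1.le 1 y, hu.periodic s hs.1.le y])
    (fun y => ((hu.hasDerivAt hs.1.le 1 y).const_mul ν).sub
      ((hfd _).comp y (hu.hasDerivAt_zero hs.1.le y))) ?_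
  exact (continuous_const.mul (hu.continuous_iteratedDeriv hs.1.le 2)).sub
    ((hu.contDiff_flux hf hs.1.le).continuous.mul (hu.continuous_iteratedDeriv hs.1.le 1))

/-- The energy identity. -/
theorem integral_sq_sub (hu : IsBurgersSolution f ν u) (hf : ContDiff ℝ ∞ f) {a b : ℝ}
    (ha : 0 ≤ a) (hab : a ≤ b) :
    (∫ x in (0 : ℝ)..1, u b x ^ 2) - ∫ x in (0 : ℝ)..1, u a x ^ 2 =
      ∫ t in a..b, -2 * (ν * ∫ x in (0 : ℝ)..1, iteratedDeriv 1 (u t) x ^ 2) := by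
  have hg : Continuous (deriv f) := by
    simpa only [iteratedDeriv_one] using (contDiff_iteratedDeriv hf 1).continuous
  -- A primitive of `s f'(s)` turns the transport term `u f'(u) u_x` into an exact derivative, which
  -- integrates to zero over a period.
  have hGd : ∀ y, HasDerivAt (fun y => ∫ s in (0 : ℝ)..y, s * deriv f s) (y * deriv f y) y :=
    fun y => (continuous_id.mul hg).integral_hasStrictDerivAt 0 y |>.hasDerivAt
  have h := integral_sub_integral_eq (E := fun t x => u t x ^ 2)
    (Q := fun t x => 2 * u t x * (ν * iteratedDeriv 2 (u t) x
      - deriv f (u t x) * iteratedDeriv 1 (u t) x)) (hu.smooth.continuousOn.pow 2)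
    ((continuousOn_const.mul hu.smooth.continuousOn).mul (hu.continuousOn_time_deriv hf))
    (fun s hs y => ((hu.hasDerivAt_time_zero hf hs y).pow 2).congr_deriv (by simp)) ha hab
  rw [h]
  refine intervalIntegral.integral_congr_ae (Filter.Eventually.of_forall fun s hs => ?_)
  rw [uIoc_of_le hab] at hs
  have hs0 : 0 ≤ s := ha.trans hs.1.le
  have hc0 : Continuous (u s) := (hu.contDiff hs0).continuous
  have hc1 := hu.continuous_iteratedDeriv hs0 1
  have hc2 := hu.continuous_iteratedDeriv hs0 2
  have hcg := (hu.contDiff_flux hf hs0).continuous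
  have h0 := integral_eq_zero_of_hasDerivAt_periodic
    (P := fun y => 2 * ν * (u s y * iteratedDeriv 1 (u s) y)
      - 2 * ∫ r in (0 : ℝ)..(u s y), r * deriv f r)
    (P' := fun y => 2 * u s y * (ν * iteratedDeriv 2 (u s) y
      - deriv f (u s y) * iteratedDeriv 1 (u s) y) + 2 * ν * iteratedDeriv 1 (u s) y ^ 2)
    (fun y => by simp only [hu.periodic_deriv hs0 1 y, hu.periodic s hs0 y])
    (fun y => by
      have e1 := (((hu.hasDerivAt_zero hs0 y).mul (hu.hasDerivAt hs0 1 y)).const_mul (2 * ν))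
      have e2 := ((hGd (u s y)).comp y (hu.hasDerivAt_zero hs0 y)).const_mul 2
      exact (e1.sub e2).congr_deriv (by ring)) (by fun_prop)
  rw [intervalIntegral.integral_add (Continuous.intervalIntegrable (by fun_prop) _ _)
    (Continuous.intervalIntegrable (by fun_prop) _ _), intervalIntegral.integral_const_mul] at h0
  linarith

end IsBurgersSolution

/-! ### Bounds for derivatives of compositions -/

/-- In Faà di Bruno's formula the orders of the derivatives of `w` in each term add up to `n`, so
bounds of the form `K ^ i` reproduce themselves. -/
theorem exists_iteratedDeriv_comp_bound {g : ℝ → ℝ} (hg : ContDiff ℝ ∞ g) (R : ℝ) (n : ℕ) :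
    ∃ C : ℝ, 0 ≤ C ∧ ∀ w : ℝ → ℝ, ContDiff ℝ ∞ w → ∀ x K : ℝ, |w x| ≤ R →
      (∀ i, 1 ≤ i → i ≤ n → |iteratedDeriv i w x| ≤ K ^ i) →
      |iteratedDeriv n (fun y => g (w y)) x| ≤ C * K ^ n := by
  have h1 : ∀ i : ℕ, ∃ c : ℝ, ∀ y ∈ Icc (-R) R, ‖iteratedDeriv i g y‖ ≤ c := fun i =>
    isCompact_Icc.exists_bound_of_continuousOn (contDiff_iteratedDeriv hg i).continuous.continuousOn
  choose c hc using h1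
  refine ⟨n.factorial * ∑ i ∈ Finset.range (n + 1), |c i|, by positivity, fun w hw x K hx hK => ?_⟩
  have h := norm_iteratedFDeriv_comp_le (𝕜 := ℝ) hg hw (n := n) (by exact_mod_cast le_top) x
    (C := ∑ i ∈ Finset.range (n + 1), |c i|) (D := K) (fun i hi => ?_) (fun i hi hin => ?_)
  · rw [norm_iteratedFDeriv_eq_norm_iteratedDeriv] at h
    exact h
  · rw [norm_iteratedFDeriv_eq_norm_iteratedDeriv]
    calc ‖iteratedDeriv i g (w x)‖ ≤ |c i| := (hc i _ (abs_le.1 hx)).trans (le_abs_self _)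
      _ ≤ _ := Finset.single_le_sum (f := fun i => |c i|) (fun j _ => abs_nonneg _)
        (Finset.mem_range.2 (Nat.lt_succ_of_le hi))
  · rw [norm_iteratedFDeriv_eq_norm_iteratedDeriv]
    exact hK i hi hin

theorem iteratedDeriv_mul_eq_sum {a b : ℝ → ℝ} (ha : ContDiff ℝ ∞ a) (hb : ContDiff ℝ ∞ b)
    (m : ℕ) (x : ℝ) :
    iteratedDeriv m (fun y => a y * b y) x = ∑ i ∈ Finset.range (m + 1),
      m.choose i * iteratedDeriv i a x * iteratedDeriv (m - i) b x :=
  iteratedDeriv_fun_mul (ha.of_le (by exact_mod_cast le_top)).contDiffAt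
    (hb.of_le (by exact_mod_cast le_top)).contDiffAt

theorem iteratedDeriv_iteratedDeriv (f : ℝ → ℝ) (m n : ℕ) :
    iteratedDeriv m (iteratedDeriv n f) = iteratedDeriv (m + n) f := by
  simp only [iteratedDeriv_eq_iterate, ← Function.iterate_add_apply]

/-- The derivative of order `n + 1` of `g(w) w'` differs from `g(w)` times the derivative of order
`n + 2` of `w` by a term of lower order. -/
theorem exists_commutator_bound {g : ℝ → ℝ} (hg : ContDiff ℝ ∞ g) (R : ℝ) (n : ℕ) :
    ∃ C : ℝ, 0 ≤ C ∧ ∀ w : ℝ → ℝ, ContDiff ℝ ∞ w → ∀ x K : ℝ, 0 ≤ K → |w x| ≤ R →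
      |iteratedDeriv 1 w x| ≤ K → (∀ i, 1 ≤ i → i ≤ n → |iteratedDeriv i w x| ≤ K ^ i) →
      |iteratedDeriv (n + 1) (fun y => g (w y) * iteratedDeriv 1 w y) x
        - g (w x) * iteratedDeriv (n + 2) w x| ≤
      C * (K * |iteratedDeriv (n + 1) w x| + K ^ (n + 2)) := by
  have hg' : ContDiff ℝ ∞ (deriv g) := by simpa [iteratedDeriv_one] using contDiff_iteratedDeriv hg 1
  choose c hc0 hc using exists_iteratedDeriv_comp_bound hg R
  choose d hd0 hd using exists_iteratedDeriv_comp_bound hg' R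
  refine ⟨(∑ k ∈ Finset.range n, (n + 1).choose (k + 1) * c (k + 1)) +
    ∑ k ∈ Finset.range (n + 1), n.choose k * d k, add_nonneg (Finset.sum_nonneg fun k _ =>
    mul_nonneg (Nat.cast_nonneg _) (hc0 _)) (Finset.sum_nonneg fun k _ =>
    mul_nonneg (Nat.cast_nonneg _) (hd0 _)), fun w hw x K hK hx h1 hj => ?_⟩
  set E := K * |iteratedDeriv (n + 1) w x| + K ^ (n + 2) with hE
  have hw1 : ContDiff ℝ ∞ (iteratedDeriv 1 w) := contDiff_iteratedDeriv hw 1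
  have hgw : ContDiff ℝ ∞ (fun y => g (w y)) := hg.comp hw
  have hgw' : ContDiff ℝ ∞ (fun y => deriv g (w y)) := hg'.comp hw
  have hmid : ∀ k, 1 ≤ k → k ≤ n → K ^ k * |iteratedDeriv (n + 2 - k) w x| ≤ E := fun k hk hkn => by
    rcases hk.eq_or_lt with rfl | hk2
    · rw [show n + 2 - 1 = n + 1 by omega, pow_one, hE]
      have : 0 ≤ K ^ (n + 2) := by positivity
      linarith
    · have := hj (n + 2 - k) (by omega) (by omega)
      calc K ^ k * |iteratedDeriv (n + 2 - k) w x| ≤ K ^ k * K ^ (n + 2 - k) := by gcongr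
        _ = K ^ (n + 2) := by rw [← pow_add]; congr 1; omega
        _ ≤ E := by rw [hE]; have : 0 ≤ K * |iteratedDeriv (n + 1) w x| := by positivity
                    linarith
  -- The composition bound cannot be used here: it would need `K ^ (n + 1)` as a bound for the
  -- derivative of order `n + 1`, which is not assumed. One differentiation is carried out by hand,
  -- so that this derivative enters linearly.
  have htop : |iteratedDeriv (n + 1) (fun y => g (w y)) x * iteratedDeriv 1 w x| ≤
      (∑ k ∈ Finset.range (n + 1), n.choose k * d k) * E := by
    have e1 : deriv (fun y => g (w y)) = fun y => deriv g (w y) * iteratedDeriv 1 w y := by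
      funext y
      rw [iteratedDeriv_one]
      exact ((hg.differentiable (by simp) (w y)).hasDerivAt.comp y
        (hw.differentiable (by simp) y).hasDerivAt).deriv
    rw [iteratedDeriv_succ', e1, iteratedDeriv_mul_eq_sum hgw' hw1, abs_mul, Finset.sum_mul]
    calc _ ≤ (∑ i ∈ Finset.range (n + 1), |(n.choose i : ℝ) *
            iteratedDeriv i (fun y => deriv g (w y)) x
            * iteratedDeriv (n - i) (iteratedDeriv 1 w) x|) * |iteratedDeriv 1 w x| := by
          gcongr; exact Finset.abs_sum_le_sum_abs _ _
      _ ≤ _ := by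
          rw [Finset.sum_mul]
          refine Finset.sum_le_sum fun k hk => ?_
          have hkn : k ≤ n := Nat.lt_succ_iff.1 (Finset.mem_range.1 hk)
          have hdk := hd k w hw x K hx (fun i hi hik => hj i hi (hik.trans hkn))
          rw [iteratedDeriv_iteratedDeriv, abs_mul, abs_mul, Nat.abs_cast]
          have hEk : K ^ k * |iteratedDeriv (n - k + 1) w x| * K ≤ E := by
            rcases Nat.eq_zero_or_pos k with rfl | hk0
            · simp only [pow_zero, one_mul, Nat.sub_zero, hE]
              have : 0 ≤ K ^ (n + 2) := by positivity
              linarith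
            · have := hj (n - k + 1) (by omega) (by omega)
              calc K ^ k * |iteratedDeriv (n - k + 1) w x| * K ≤ K ^ k * K ^ (n - k + 1) * K := by
                    gcongr
                _ = K ^ (n + 2) := by
                    rw [← pow_add, ← pow_succ]; congr 1; omega
                _ ≤ E := by
                    rw [hE]
                    have : 0 ≤ K * |iteratedDeriv (n + 1) w x| := by positivity
                    linarith
          have hdk0 := hd0 k
          calc (n.choose k : ℝ) * |iteratedDeriv k (fun y => deriv g (w y)) x| *
                |iteratedDeriv (n - k + 1) w x| * |iteratedDeriv 1 w x|
              ≤ (n.choose k : ℝ) * (d k * K ^ k) * |iteratedDeriv (n - k + 1) w x| * K := by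
                gcongr
            _ = (n.choose k : ℝ) * d k * (K ^ k * |iteratedDeriv (n - k + 1) w x| * K) := by ring
            _ ≤ _ := by gcongr
  rw [iteratedDeriv_mul_eq_sum hgw hw1, Finset.sum_range_succ, Finset.sum_range_succ']
  simp only [Nat.choose_zero_right, Nat.cast_one, iteratedDeriv_zero, one_mul, Nat.sub_zero,
    Nat.choose_self, Nat.sub_self, iteratedDeriv_iteratedDeriv]
  rw [show ∀ a b c : ℝ, a + b + c - b = a + c by intros; ring, add_mul]
  refine (abs_add_le _ _).trans (add_le_add ?_ htop)
  rw [Finset.sum_mul]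
  refine (Finset.abs_sum_le_sum_abs _ _).trans (Finset.sum_le_sum fun k hk => ?_)
  have hkn : k + 1 ≤ n := Finset.mem_range.1 hk
  have hck := hc (k + 1) w hw x K hx (fun i hi hik => hj i hi (hik.trans hkn))
  have := hmid (k + 1) (by omega) hkn
  rw [abs_mul, abs_mul, Nat.abs_cast, show n + 1 - (k + 1) + 1 = n + 2 - (k + 1) by omega]
  calc _ ≤ ((n + 1).choose (k + 1) : ℝ) * (c (k + 1) * K ^ (k + 1)) *
        |iteratedDeriv (n + 2 - (k + 1)) w x| := by gcongr
    _ = ((n + 1).choose (k + 1) : ℝ) * c (k + 1) *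
        (K ^ (k + 1) * |iteratedDeriv (n + 2 - (k + 1)) w x|) := by ring
    _ ≤ _ := by
      have := hc0 (k + 1)
      gcongr

/-! ### Pointwise bounds for derivatives of solutions -/

/-- The algebra of Bernstein's method for `φ = τ p² + A q²`, with `p`, `q` the derivatives of order
`n + 1` and `n` at a spatial maximum of `φ` and `E₁`, `E₂` the commutator terms. The hypotheses
`h1`, `h2` are `φ_x = 0` and `φ_xx ≤ 0`; they remove the drift and the diffusion, leaving the
damping `-2 A ν p²`. The condition `h ≤ ν` enters through `A ≤ A' K`. -/
theorem bernstein_inequality {ν g τ h A A' B C₁ C₂ K p q p₁ p₂ E₁ E₂ : ℝ} {n : ℕ}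
    (hν : 0 < ν) (hτ : 0 ≤ τ) (hτh : τ ≤ h / 2) (hh : 0 < h) (hhν : h ≤ ν) (hB : 1 ≤ B)
    (hK : K = 2 * B / h) (hA' : A' = 1 + 2 * B * C₁) (hA : A = A' / ν) (hC₁ : 0 ≤ C₁) (hC₂ : 0 ≤ C₂)
    (hE₁ : |E₁| ≤ C₁ * (K * |p| + K ^ (n + 2)))
    (hE₂ : |E₂| ≤ C₂ * (K * |q| + K ^ (n + 1))) (hq : |q| ≤ K ^ n)
    (h1 : τ * (2 * (p * p₁)) + A * (2 * (q * p)) = 0)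
    (h2 : τ * (2 * (p₁ * p₁ + p * p₂)) + A * (2 * (p * p + q * p₁)) ≤ 0) :
    p ^ 2 + τ * (2 * (p * (ν * p₂ - g * p₁ - E₁))) + A * (2 * (q * (ν * p₁ - g * p - E₂))) ≤
      (2 * B * C₁ + 4 * A' * C₂) * K ^ (2 * (n + 1)) := by
  have hK0 : 0 < K := by rw [hK]; positivity
  have hhK : h * K = 2 * B := by rw [hK]; field_simp
  have hA'0 : 0 < A' := by rw [hA']; positivity
  have hA0 : 0 < A := by rw [hA]; positivity
  have hAν : A * ν = A' := by rw [hA]; field_simp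
  have hAK : A ≤ A' * K := by
    rw [hA, hK, div_le_iff₀ hν]
    have : 1 ≤ 2 * B / h * ν := by
      rw [div_mul_eq_mul_div, le_div_iff₀ hh]; nlinarith
    nlinarith
  have id1 : p ^ 2 + τ * (2 * (p * (ν * p₂ - g * p₁ - E₁))) + A * (2 * (q * (ν * p₁ - g * p - E₂)))
      = ν * (τ * (2 * (p₁ * p₁ + p * p₂)) + A * (2 * (p * p + q * p₁)))
        - g * (τ * (2 * (p * p₁)) + A * (2 * (q * p)))
        + (p ^ 2 - 2 * ν * τ * p₁ ^ 2 - 2 * (A * ν) * p ^ 2 - 2 * τ * (p * E₁) - 2 * A * (q * E₂)) := by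
    ring
  have b1 : -(2 * τ * (p * E₁)) ≤ 2 * B * C₁ * (2 * p ^ 2 + K ^ (2 * (n + 1))) := by
    have hp2 : K * |p| * |p| = K * p ^ 2 := by rw [mul_assoc, abs_mul_abs_self, sq]
    have e2 : |p| * K ^ (n + 1) ≤ p ^ 2 + K ^ (2 * (n + 1)) := by
      rw [mul_comm 2, pow_mul, ← sq_abs p]
      nlinarith [sq_nonneg (|p| - K ^ (n + 1)), sq_nonneg (|p|), sq_nonneg (K ^ (n + 1))]
    calc -(2 * τ * (p * E₁)) ≤ |2 * τ * (p * E₁)| := neg_le_abs _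
      _ = 2 * τ * (|p| * |E₁|) := by rw [abs_mul, abs_mul p, abs_of_nonneg (by positivity)]
      _ ≤ h * (|p| * (C₁ * (K * |p| + K ^ (n + 2)))) := by
          gcongr
          linarith
      _ = (h * K) * C₁ * (|p| * |p| + |p| * K ^ (n + 1)) := by ring
      _ ≤ (h * K) * C₁ * (2 * p ^ 2 + K ^ (2 * (n + 1))) := by
          rw [abs_mul_abs_self]
          refine mul_le_mul_of_nonneg_left ?_ (by positivity)
          linarith
      _ = _ := by rw [hhK]
  have b2 : -(2 * A * (q * E₂)) ≤ 4 * A' * C₂ * K ^ (2 * (n + 1)) := by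
    calc -(2 * A * (q * E₂)) ≤ |2 * A * (q * E₂)| := neg_le_abs _
      _ = 2 * A * (|q| * |E₂|) := by rw [abs_mul, abs_mul q, abs_of_nonneg (by positivity)]
      _ ≤ 2 * (A' * K) * (K ^ n * (C₂ * (K * K ^ n + K ^ (n + 1)))) := by
          gcongr
          exact hE₂.trans (by gcongr)
      _ = _ := by ring
  have b3 : 0 ≤ 2 * ν * τ * p₁ ^ 2 := by positivity
  have b4 : ν * (τ * (2 * (p₁ * p₁ + p * p₂)) + A * (2 * (p * p + q * p₁))) ≤ 0 :=
    mul_nonpos_of_nonneg_of_nonpos hν.le h2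
  rw [id1, h1, hAν]
  -- This is what fixes `A'`: the damping absorbs both the `p²` from differentiating the weight `τ`
  -- and the `p²` part of the commutator.
  have b5 : p ^ 2 - 2 * A' * p ^ 2 + 2 * B * C₁ * (2 * p ^ 2) = - p ^ 2 := by rw [hA']; ring
  nlinarith [sq_nonneg p]

/-- From above, `u_x ≤ D`. From below, `-ν u_x` is the difference of `f(u) - ν u_x`, which is at
most `F + D`, and `f(u)`, which is at least `-F`. -/
theorem exists_pointwise_derivative_bound {f : ℝ → ℝ} (hf : ContDiff ℝ ∞ f)
    (hconv : ∀ x, 0 ≤ iteratedDeriv 2 f x) {D : ℝ} (hD : 0 < D) :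
    ∃ B : ℝ, 1 ≤ B ∧ ∀ ν : ℝ, 0 < ν → ν ≤ 1 → ∀ u : ℝ → ℝ → ℝ, IsBurgersSolution f ν u →
      (∀ x, |u 0 x| ≤ D) → (∀ x, |iteratedDeriv 1 (u 0) x| ≤ D) →
      ∀ t, 0 ≤ t → ∀ x, |iteratedDeriv 1 (u t) x| ≤ B / ν := by
  obtain ⟨F, hF⟩ := isCompact_Icc.exists_bound_of_continuousOn (s := Icc (-D) D)
    hf.continuous.continuousOn
  have hF0 : 0 ≤ F := (norm_nonneg _).trans (hF 0 ⟨by linarith, hD.le⟩)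
  refine ⟨2 * F + D + 1, by linarith, fun ν hν hν1 u hu h0 h1 t ht x => ?_⟩
  have hu0 : ∀ t, 0 ≤ t → ∀ x, |f (u t x)| ≤ F := fun t ht x =>
    hF _ (abs_le.1 (hu.abs_le_of_initial hf hν h0 ht x))
  have e1 := hu.deriv_le_of_initial hf hν hconv (fun x => (le_abs_self _).trans (h1 x)) ht x
  have e2 := hu.flux_sub_le hf hν (Z := F + D) (fun y => by
    have a1 := (abs_le.1 (hu0 0 le_rfl y)).2
    have a2 := (abs_le.1 (h1 y)).1
    nlinarith) ht x
  have e3 := (abs_le.1 (hu0 t ht x)).1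
  rw [abs_le, neg_le, le_div_iff₀ hν, le_div_iff₀ hν]
  constructor <;> nlinarith

/-- Bernstein's method, by induction on the order: over a time `h/2` smoothing gains one derivative
at the cost of a factor of order `1/h`. The bounds already obtained are used with `h/2` in place of
`h`, whence `K = 2B/h`. -/
theorem exists_derivative_bound {f : ℝ → ℝ} (hf : ContDiff ℝ ∞ f)
    (hconv : ∀ x, 0 ≤ iteratedDeriv 2 f x) {D : ℝ} (hD : 0 < D) (m : ℕ) :
    ∃ B : ℝ, 1 ≤ B ∧ ∀ ν : ℝ, 0 < ν → ν ≤ 1 → ∀ u : ℝ → ℝ → ℝ, IsBurgersSolution f ν u →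
      (∀ x, |u 0 x| ≤ D) → (∀ x, |iteratedDeriv 1 (u 0) x| ≤ D) →
      ∀ h, 0 < h → h ≤ ν → ∀ t, h ≤ t → ∀ x, ∀ j, 1 ≤ j → j ≤ m + 1 →
        |iteratedDeriv j (u t) x| ≤ (B / h) ^ j := by
  induction m with
  | zero =>
    obtain ⟨B, hB, H⟩ := exists_pointwise_derivative_bound hf hconv hD
    refine ⟨B, hB, fun ν hν hν1 u hu h0 h1 h hh hhν t ht x j hj1 hj2 => ?_⟩
    obtain rfl : j = 1 := by omega
    rw [pow_one]
    exact (H ν hν hν1 u hu h0 h1 t (hh.le.trans ht) x).trans (by gcongr)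
  | succ n ih =>
    obtain ⟨B, hB, H⟩ := ih
    have hg : ContDiff ℝ ∞ (deriv f) := by
      simpa [iteratedDeriv_one] using contDiff_iteratedDeriv hf 1
    obtain ⟨C₁, hC₁, H₁⟩ := exists_commutator_bound hg D (n + 1)
    obtain ⟨C₂, hC₂, H₂⟩ := exists_commutator_bound hg D n
    set A' := 1 + 2 * B * C₁ with hA'
    set C₃ := A' + (2 * B * C₁ + 4 * A' * C₂) with hC₃
    have hA'1 : 1 ≤ A' := by rw [hA']; nlinarith [mul_nonneg (zero_le_one.trans hB) hC₁]
    have hC₃1 : 1 ≤ C₃ := by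
      rw [hC₃]
      have : 0 ≤ 2 * B * C₁ + 4 * A' * C₂ := by positivity
      linarith
    refine ⟨2 * B * C₃, by nlinarith, fun ν hν hν1 u hu h0 h1 h hh hhν t ht x j hj1 hj2 => ?_⟩
    set K := 2 * B / h with hK
    have hK0 : 0 < K := by positivity
    have hK2 : B / (h / 2) = K := by rw [hK]; field_simp
    have hlow : ∀ s, t - h / 2 ≤ s → ∀ y, ∀ i, 1 ≤ i → i ≤ n + 1 →
        |iteratedDeriv i (u s) y| ≤ K ^ i := fun s hs y i hi1 hi2 => by
      have := H ν hν hν1 u hu h0 h1 (h / 2) (by linarith) (by linarith) s (by linarith) y i hi1 hi2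
      rwa [hK2] at this
    have hfin : 2 * B * C₃ / h = C₃ * K := by rw [hK]; ring
    rw [hfin, mul_pow]
    rcases Nat.lt_or_ge j (n + 2) with hj | hj
    · have e := hlow t (by linarith) x j hj1 (by omega)
      refine e.trans (le_mul_of_one_le_left (by positivity) (one_le_pow₀ hC₃1))
    obtain rfl : j = n + 2 := by omega
    set a := t - h / 2 with ha
    have ha0 : 0 < a := by rw [ha]; linarith
    set A := A' / ν with hA
    have hA0 : 0 < A := by positivity
    have hsq : ∀ s ∈ Ioc a t, ∀ k y, HasDerivAt (fun y => iteratedDeriv k (u s) y ^ 2)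
        (2 * (iteratedDeriv k (u s) y * iteratedDeriv (k + 1) (u s) y)) y := fun s hs k y =>
      ((hu.hasDerivAt (ha0.trans hs.1).le k y).pow 2).congr_deriv (by ring)
    have hsq2 : ∀ s ∈ Ioc a t, ∀ k y, HasDerivAt
        (fun y => 2 * (iteratedDeriv k (u s) y * iteratedDeriv (k + 1) (u s) y))
        (2 * (iteratedDeriv (k + 1) (u s) y * iteratedDeriv (k + 1) (u s) y
          + iteratedDeriv k (u s) y * iteratedDeriv (k + 2) (u s) y)) y := fun s hs k y =>
      ((hu.hasDerivAt (ha0.trans hs.1).le k y).mul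
        (hu.hasDerivAt (ha0.trans hs.1).le (k + 1) y)).const_mul 2
    have hsqt : ∀ s ∈ Ioc a t, ∀ k y, HasDerivAt (fun s => iteratedDeriv k (u s) y ^ 2)
        (2 * (iteratedDeriv k (u s) y * (ν * iteratedDeriv (k + 2) (u s) y
        - iteratedDeriv k (fun y => deriv f (u s y) * iteratedDeriv 1 (u s) y) y))) s :=
      fun s hs k y =>
      ((hu.hasDerivAt_time hf (ha0.trans hs.1) k y).pow 2).congr_deriv (by ring)
    have hAK : A ≤ A' * K := by
      rw [hA, hK, div_le_iff₀ hν]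
      have : 1 ≤ 2 * B / h * ν := by
        rw [div_mul_eq_mul_div, le_div_iff₀ hh]; nlinarith
      nlinarith
    -- The weight `s - a` vanishes at the initial time `a`, where nothing is known of the top
    -- derivative; the lower-order square, already bounded, supplies the damping.
    have key := le_add_mul_of_drift_diffusion (a := a) (b := t) (S := A' * K * K ^ (2 * (n + 1)))
      (M := (2 * B * C₁ + 4 * A' * C₂) * K ^ (2 * (n + 2)))
      (φ := fun s y => (s - a) * iteratedDeriv (n + 2) (u s) y ^ 2
        + A * iteratedDeriv (n + 1) (u s) y ^ 2)
      (φ₁ := _) (φ₂ := _) (φt := _)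
      ((((continuousOn_fst.sub continuousOn_const).mul
        ((hu.continuousOn_iteratedDeriv (n + 2)).pow 2)).add
        (continuousOn_const.mul ((hu.continuousOn_iteratedDeriv (n + 1)).pow 2))).mono
        (prod_mono (Icc_subset_Ici_self.trans (Ici_subset_Ici.2 ha0.le)) le_rfl))
      (fun s hs y => by
        simp only [hu.periodic_deriv (ha0.le.trans hs.1) _ y])
      (fun y => by
        have e := hlow a le_rfl y (n + 1) (by omega) le_rfl
        rw [sub_self, zero_mul, zero_add, ← sq_abs]
        calc A * |iteratedDeriv (n + 1) (u a) y| ^ 2 ≤ A' * K * (K ^ (n + 1)) ^ 2 := by gcongr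
          _ = _ := by ring)
      (fun s hs y => ((hsq s hs (n + 2) y).const_mul (s - a)).add
        ((hsq s hs (n + 1) y).const_mul A))
      (fun s hs y => ((hsq2 s hs (n + 2) y).const_mul (s - a)).add
        ((hsq2 s hs (n + 1) y).const_mul A))
      (fun s hs y => (((hasDerivAt_id s).sub_const a).mul (hsqt s hs (n + 2) y)).add
        ((hsqt s hs (n + 1) y).const_mul A))
      (fun s hs y _ h1 h2 => by
        have hs0 : 0 ≤ s := (ha0.trans hs.1).le
        have hw := hu.contDiff hs0
        have hwD := hu.abs_le_of_initial hf hν h0 hs0 y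
        have hl := hlow s hs.1.le y
        have hl1 : |iteratedDeriv 1 (u s) y| ≤ K := by simpa using hl 1 le_rfl (by omega)
        have c1 := H₁ (u s) hw y K hK0.le hwD hl1 hl
        have c2 := H₂ (u s) hw y K hK0.le hwD hl1 (fun i hi hin => hl i hi (by omega))
        have := bernstein_inequality (g := deriv f (u s y)) (τ := s - a) (n := n + 1)
          (p₂ := iteratedDeriv (n + 4) (u s) y)
          hν (sub_nonneg.2 hs.1.le) (by have := hs.2; rw [ha]; linarith) hh hhν hB hK hA' hA hC₁ hC₂
          c1 c2 (hl (n + 1) (by omega) le_rfl) h1 h2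
        refine le_trans (le_of_eq ?_) this
        simp only [id]
        ring)
      (t := t) ⟨by rw [ha]; linarith, le_rfl⟩ x
    have hta : t - a = h / 2 := by rw [ha]; ring
    have hhK : h * K = 2 * B := by rw [hK]; field_simp
    simp only [hta] at key
    have hmain : iteratedDeriv (n + 2) (u t) x ^ 2 ≤ C₃ * K ^ (2 * (n + 2)) := by
      have t1 : h / 2 * iteratedDeriv (n + 2) (u t) x ^ 2 ≤
          h / 2 * (C₃ * K ^ (2 * (n + 2))) := by
        have t2 : 0 ≤ A * iteratedDeriv (n + 1) (u t) x ^ 2 := by positivity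
        have t3 : A' * K * K ^ (2 * (n + 1)) ≤ h / 2 * (A' * K ^ (2 * (n + 2))) := by
          have : h / 2 * (A' * K ^ (2 * (n + 2))) = (h * K) / 2 * (A' * K * K ^ (2 * (n + 1))) := by
            ring
          rw [this, hhK]
          have : 0 ≤ A' * K * K ^ (2 * (n + 1)) := by positivity
          nlinarith
        rw [hC₃]
        nlinarith
      exact le_of_mul_le_mul_left t1 (by linarith)
    -- Since `C₃ ≥ 1`, it may be replaced by its power, which puts the bound in the form `(C₃ K) ^
    -- (n + 2)` required by the induction.
    refine abs_le_of_sq_le_sq (hmain.trans ?_) (by positivity)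
    calc C₃ * K ^ (2 * (n + 2)) ≤ C₃ ^ (2 * (n + 2)) * K ^ (2 * (n + 2)) := by
          gcongr
          exact le_self_pow₀ hC₃1 (by omega)
      _ = _ := by ring

/-! ### Finite differences and interpolation of `L^p` norms -/

/-- Numerical differentiation: the `j`-th derivative is controlled by the values at equally spaced
points and by a higher derivative. -/
theorem exists_finite_difference_bound {j N : ℕ} (hjN : j ≤ N) :
    ∃ C : ℝ, 0 < C ∧ ∀ w : ℝ → ℝ, ContDiff ℝ ∞ w → ∀ x r M : ℝ, 0 < r →
      (∀ y, |iteratedDeriv (N + 1) w y| ≤ M) →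
      r ^ j * |iteratedDeriv j w x| ≤
        C * ((∑ k ∈ Finset.range (N + 1), |w (x + k * r)|) + r ^ (N + 1) * M) := by
  set s := Finset.range (N + 1) with hs
  set v : ℕ → ℝ := fun k => (k : ℝ) with hv
  have hvs : Set.InjOn v s := fun a _ b _ h => Nat.cast_injective h
  set c : ℕ → ℝ := fun k => (Lagrange.basis s v k).coeff j with hc
  refine ⟨j.factorial * ∑ k ∈ s, |c k| * (1 + (k : ℝ) ^ (N + 1)) + 1, by positivity,
    fun w hw x r M hr hM => ?_⟩
  have hM0 : 0 ≤ M := (abs_nonneg _).trans (hM 0)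
  set P : Polynomial ℝ := ∑ i ∈ s,
    Polynomial.C (iteratedDeriv i w x / i.factorial * r ^ i) * Polynomial.X ^ i with hP
  have hcoeff : P.coeff j = iteratedDeriv j w x / j.factorial * r ^ j := by
    rw [hP, Polynomial.finsetSum_coeff, Finset.sum_eq_single j]
    · rw [Polynomial.coeff_C_mul_X_pow, if_pos rfl]
    · intro b _ hb
      rw [Polynomial.coeff_C_mul_X_pow, if_neg (Ne.symm hb)]
    · intro h
      exact absurd (Finset.mem_range.2 (Nat.lt_succ_of_le hjN)) h
  have hdeg : P.degree < s.card := by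
    rw [hs, Finset.card_range]
    refine (Polynomial.degree_sum_le _ _).trans_lt ?_
    rw [Finset.sup_lt_iff (by exact_mod_cast WithBot.bot_lt_coe (N + 1))]
    intro i hi
    refine (Polynomial.degree_C_mul_X_pow_le i _).trans_lt ?_
    exact_mod_cast Finset.mem_range.1 hi
  -- The Taylor polynomial, in the variable scaled by `r`, is recovered from its values at `0, …, N`
  -- by Lagrange interpolation; these values are those of `w` up to the Taylor remainder.
  have hsum : P.coeff j = ∑ k ∈ s, P.eval (v k) * c k := by
    conv_lhs => rw [Lagrange.eq_interpolate hvs hdeg, Lagrange.interpolate_apply,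
      Polynomial.finsetSum_coeff]
    simp only [Polynomial.coeff_C_mul, hc]
  have heval : ∀ k : ℕ, |P.eval (v k)| ≤ |w (x + k * r)| + (k : ℝ) ^ (N + 1) * (r ^ (N + 1) * M) := by
    intro k
    have hPe : P.eval (v k) = ∑ i ∈ s, iteratedDeriv i w x / i.factorial * r ^ i * (k : ℝ) ^ i := by
      rw [hP, Polynomial.eval_finsetSum]
      simp [hv]
    rcases Nat.eq_zero_or_pos k with rfl | hk
    · have : P.eval (v 0) = w x := by
        rw [hPe, Finset.sum_eq_single 0]
        · simp
        · intro b _ hb; simp [hb]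
        · intro h; exact absurd (Finset.mem_range.2 (Nat.succ_pos N)) h
      rw [this]; simp
    have hk0 : (0 : ℝ) < k := by exact_mod_cast hk
    have hne : x ≠ x + k * r := by have := mul_pos hk0 hr; intro h; linarith
    obtain ⟨y, _, hy⟩ := taylor_mean_remainder_lagrange_iteratedDeriv (f := w) (n := N) hne
      (hw.of_le (by exact_mod_cast le_top)).contDiffOn
    have hT : taylorWithinEval w N (uIcc x (x + k * r)) x (x + k * r) = P.eval (v k) := by
      rw [taylor_within_apply, hPe]
      refine Finset.sum_congr rfl fun i _ => ?_
      rw [iteratedDerivWithin_eq_iteratedDeriv (uniqueDiffOn_uIcc hne)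
        (hw.of_le (by exact_mod_cast le_top)).contDiffAt left_mem_uIcc, smul_eq_mul,
        add_sub_cancel_left, mul_pow]
      ring
    rw [hT, add_sub_cancel_left, mul_pow] at hy
    have hfac : (1 : ℝ) ≤ (N + 1).factorial := by exact_mod_cast Nat.succ_le_of_lt (Nat.factorial_pos _)
    have hrem : |iteratedDeriv (N + 1) w y * ((k : ℝ) ^ (N + 1) * r ^ (N + 1)) / (N + 1).factorial| ≤
        (k : ℝ) ^ (N + 1) * (r ^ (N + 1) * M) := by
      rw [abs_div, Nat.abs_cast, div_le_iff₀ (by positivity), abs_mul,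
        abs_of_nonneg (by positivity : (0 : ℝ) ≤ (k : ℝ) ^ (N + 1) * r ^ (N + 1))]
      calc _ ≤ M * ((k : ℝ) ^ (N + 1) * r ^ (N + 1)) := by gcongr; exact hM y
        _ = (k : ℝ) ^ (N + 1) * (r ^ (N + 1) * M) * 1 := by ring
        _ ≤ _ := by gcongr
    have e : P.eval (v k) = w (x + k * r) -
      iteratedDeriv (N + 1) w y * ((k : ℝ) ^ (N + 1) * r ^ (N + 1)) / (N + 1).factorial := by
      linarith
    rw [e]
    exact (abs_sub _ _).trans (by gcongr)
  set W := ∑ k ∈ s, |w (x + k * r)| with hW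
  have hW0 : 0 ≤ W := Finset.sum_nonneg fun _ _ => abs_nonneg _
  have hfin : r ^ j * |iteratedDeriv j w x| = j.factorial * |P.coeff j| := by
    rw [hcoeff, abs_mul, abs_div, Nat.abs_cast, abs_of_pos (by positivity : 0 < r ^ j)]
    field_simp
  rw [hfin, hsum]
  calc (j.factorial : ℝ) * |∑ k ∈ s, P.eval (v k) * c k|
      ≤ j.factorial * ∑ k ∈ s, |c k| * (1 + (k : ℝ) ^ (N + 1)) * (W + r ^ (N + 1) * M) := by
        gcongr
        refine (Finset.abs_sum_le_sum_abs _ _).trans (Finset.sum_le_sum fun k hk => ?_)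
        rw [abs_mul, mul_comm, mul_assoc]
        gcongr
        refine (heval k).trans ?_
        have h1 : |w (x + k * r)| ≤ W :=
          Finset.single_le_sum (f := fun k : ℕ => |w (x + k * r)|) (fun _ _ => abs_nonneg _) hk
        have h2 : 0 ≤ (k : ℝ) ^ (N + 1) * W := by positivity
        have h3 : 0 ≤ r ^ (N + 1) * M := by positivity
        nlinarith
    _ = (j.factorial * ∑ k ∈ s, |c k| * (1 + (k : ℝ) ^ (N + 1))) * (W + r ^ (N + 1) * M) := by
        rw [← Finset.sum_mul, mul_assoc]
    _ ≤ _ := by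
        have h3 : 0 ≤ r ^ (N + 1) * M := by positivity
        rw [add_mul, one_mul]
        linarith

theorem setIntegral_Ioc_comp_add {w : ℝ → ℝ} (hp : Function.Periodic w 1) (c : ℝ) :
    ∫ x in Ioc (0 : ℝ) 1, w (x + c) = ∫ x in Ioc (0 : ℝ) 1, w x := by
  rw [← intervalIntegral.integral_of_le zero_le_one, ← intervalIntegral.integral_of_le zero_le_one,
    intervalIntegral.integral_comp_add_right]
  have := hp.intervalIntegral_add_eq c 0
  rw [zero_add] at this ⊢
  rwa [add_comm 1 c]

/-- A weak-type estimate for the distribution function gives a strong-type estimate for bounded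
functions. -/
theorem lintegral_rpow_le_of_distribution_le {α : Type*} [MeasurableSpace α] {μ : Measure α}
    {g : α → ℝ} (hg : AEMeasurable g μ) (hg0 : ∀ x, 0 ≤ g x) {B c κ p : ℝ} (hB : 0 < B)
    (hgB : ∀ x, g x ≤ B) (hc : 0 ≤ c) (hκ : 0 < κ) (hp : 0 < p)
    (hdist : ∀ s, 0 < s → μ {x | s < g x} ≤ ENNReal.ofReal (c * s ^ (κ - p))) :
    ∫⁻ x, ENNReal.ofReal (g x ^ p) ∂μ ≤ ENNReal.ofReal (p * (c * (B ^ κ / κ))) := by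
  rw [lintegral_rpow_eq_lintegral_meas_lt_mul μ (Filter.Eventually.of_forall hg0) hg hp,
    ENNReal.ofReal_mul hp.le]
  gcongr
  have hint : IntegrableOn (fun s : ℝ => c * s ^ (κ - 1)) (Ioc 0 B) := by
    have := (intervalIntegral.intervalIntegrable_rpow' (a := 0) (b := B)
      (by linarith : -1 < κ - 1)).const_mul c
    rwa [intervalIntegrable_iff_integrableOn_Ioc_of_le hB.le] at this
  calc ∫⁻ t in Ioi 0, μ {a | t < g a} * ENNReal.ofReal (t ^ (p - 1))
      ≤ ∫⁻ t in Ioi 0, (Ioc 0 B).indicator (fun s => ENNReal.ofReal (c * s ^ (κ - 1))) t := by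
        refine setLIntegral_mono' measurableSet_Ioi fun s hs => ?_
        have hs0 : 0 < s := hs
        by_cases hsB : s ≤ B
        · rw [indicator_of_mem (show s ∈ Ioc 0 B from ⟨hs0, hsB⟩)]
          calc _ ≤ ENNReal.ofReal (c * s ^ (κ - p)) * ENNReal.ofReal (s ^ (p - 1)) := by
                gcongr; exact hdist s hs0
            _ = _ := by
                rw [← ENNReal.ofReal_mul (by positivity), mul_assoc, ← Real.rpow_add hs0]
                congr 3; ring
        · have : {a | s < g a} = ∅ := by
            ext a; simp only [mem_ofPred_eq, mem_empty_iff_false, iff_false, not_lt]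
            exact (hgB a).trans (not_le.1 hsB).le
          rw [this]; simp
    _ ≤ ∫⁻ t, (Ioc 0 B).indicator (fun s => ENNReal.ofReal (c * s ^ (κ - 1))) t :=
        setLIntegral_le_lintegral _ _
    _ = ∫⁻ t in Ioc 0 B, ENNReal.ofReal (c * t ^ (κ - 1)) := lintegral_indicator measurableSet_Ioc _
    _ = ENNReal.ofReal (∫ t in Ioc 0 B, c * t ^ (κ - 1)) := by
        rw [ofReal_integral_eq_lintegral_ofReal hint]
        filter_upwards [self_mem_ae_restrict measurableSet_Ioc] with t ht
        exact mul_nonneg hc (Real.rpow_nonneg ht.1.le _)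
    _ ≤ _ := by
        rw [← intervalIntegral.integral_of_le hB.le, intervalIntegral.integral_const_mul,
          integral_rpow (Or.inl (by linarith)), sub_add_cancel, Real.zero_rpow hκ.ne', sub_zero]

/-- Applied to `w = u_x`. For each level `s` the step of the finite differences is chosen so that
the Taylor remainder is at most `s / 2`; Markov's inequality for the `L^1`-bounded part then
controls the distribution function. -/
theorem exists_eLpNorm_iteratedDeriv_bound (j : ℕ) {p : ℝ} (hp : 1 < p) (A : ℝ) (hA : 0 < A)
    (B : ℕ → ℝ) (hB : ∀ i, 0 < B i) :
    ∃ C : ℝ, 0 < C ∧ ∀ w : ℝ → ℝ, ContDiff ℝ ∞ w → Function.Periodic w 1 → ∀ h : ℝ, 0 < h →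
      ∫ x in Ioc (0 : ℝ) 1, |w x| ≤ A →
      (∀ i x, |iteratedDeriv i w x| ≤ B i * (h ^ (i + 1))⁻¹) →
      eLpNorm (iteratedDeriv j w) (ENNReal.ofReal p) (volume.restrict (Ioc (0 : ℝ) 1)) ≤
        ENNReal.ofReal (C * h ^ (-((j : ℝ) + 1 - 1 / p))) := by
  -- `L` extra orders in the Taylor expansion reduce the loss in the distribution estimate to
  -- `s^(-1-β)` with `β = j / (L + 1) < p - 1`, integrable against `s^(p-1)` near `0`.
  obtain ⟨L, hL⟩ := exists_nat_gt ((j : ℝ) / (p - 1))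
  have hLp : (0 : ℝ) < L + 1 := by positivity
  have hjL : (j : ℝ) / (L + 1) < p - 1 := by
    rw [div_lt_iff₀ (by linarith)] at hL
    rw [div_lt_iff₀ hLp]
    nlinarith
  set N := j + L with hN
  obtain ⟨C₁, hC₁, H₁⟩ := exists_finite_difference_bound (show j ≤ N by omega)
  set b := B j + B (N + 1) with hb
  have hb0 : 0 < b := add_pos (hB _) (hB _)
  set β := (j : ℝ) / (L + 1) with hβ
  have hβ0 : 0 ≤ β := by positivity
  set κ := p - 1 - β with hκ
  have hκ0 : 0 < κ := by rw [hκ]; linarith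
  set c₁ := 2 * C₁ * (N + 1) * A * (2 * C₁ * b) ^ β with hc₁
  have hc₁0 : 0 < c₁ := by positivity
  have hp0 : 0 < p := by linarith
  set C₂ := p * (c₁ * (b ^ κ / κ)) with hC₂
  have hC₂0 : 0 < C₂ := by positivity
  refine ⟨C₂ ^ (1 / p), by positivity, fun w hw hper h hh hwA hwB => ?_⟩
  set μ := volume.restrict (Ioc (0 : ℝ) 1) with hμ
  set g : ℝ → ℝ := fun x => h ^ (j + 1) * |iteratedDeriv j w x| with hg
  have hgc : Continuous g := continuous_const.mul (contDiff_iteratedDeriv hw j).continuous.abs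
  have hg0 : ∀ x, 0 ≤ g x := fun x => by positivity
  have hgb : ∀ x, g x ≤ b := fun x => by
    calc g x ≤ h ^ (j + 1) * (B j * (h ^ (j + 1))⁻¹) := by
          simp only [hg]; gcongr; exact hwB j x
      _ = B j := by field_simp
      _ ≤ b := by rw [hb]; linarith [hB (N + 1)]
  have hdist : ∀ s, 0 < s → μ {x | s < g x} ≤ ENNReal.ofReal ((c₁ * h) * s ^ (κ - p)) := by
    intro s hs
    -- The step is `h * ρ`, with `ρ` solving `C₁ b ρ^(L+1) = s / 2`.
    set ρ := (s / (2 * C₁ * b)) ^ (1 / ((L : ℝ) + 1)) with hρ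
    have hρ0 : 0 < ρ := by positivity
    have hρL : ρ ^ (L + 1) = s / (2 * C₁ * b) := by
      rw [hρ, ← Real.rpow_natCast, ← Real.rpow_mul (by positivity)]
      push_cast
      rw [one_div, inv_mul_cancel₀ hLp.ne', Real.rpow_one]
    have hρj : ρ ^ j = (s / (2 * C₁ * b)) ^ β := by
      rw [hρ, ← Real.rpow_natCast, ← Real.rpow_mul (by positivity)]
      congr 1
      rw [hβ]; ring
    set G : ℝ → ℝ := fun x => C₁ * h / ρ ^ j * ∑ k ∈ Finset.range (N + 1), |w (x + k * (h * ρ))|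
      with hG
    have hGc : Continuous G := by
      have := hw.continuous
      fun_prop
    have hG0 : ∀ x, 0 ≤ G x := fun x =>
      mul_nonneg (by positivity) (Finset.sum_nonneg fun _ _ => abs_nonneg _)
    have hpt : ∀ x, g x ≤ G x + s / 2 := fun x => by
      have e := H₁ w hw x (h * ρ) (B (N + 1) * (h ^ (N + 1 + 1))⁻¹) (by positivity) (hwB (N + 1))
      have e2 : g x = h / ρ ^ j * ((h * ρ) ^ j * |iteratedDeriv j w x|) := by
        simp only [hg]; rw [mul_pow]; field_simp; ring
      rw [e2]
      calc h / ρ ^ j * ((h * ρ) ^ j * |iteratedDeriv j w x|)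
          ≤ h / ρ ^ j * (C₁ * ((∑ k ∈ Finset.range (N + 1), |w (x + k * (h * ρ))|) +
            (h * ρ) ^ (N + 1) * (B (N + 1) * (h ^ (N + 1 + 1))⁻¹))) := by gcongr
        _ = G x + C₁ * B (N + 1) * ρ ^ (L + 1) := by
            simp only [hG]
            have : (h * ρ) ^ (N + 1) = h ^ (N + 1) * (ρ ^ j * ρ ^ (L + 1)) := by
              rw [mul_pow, ← pow_add, hN, add_assoc]
            rw [this]
            generalize (∑ k ∈ Finset.range (N + 1), |w (x + k * (h * ρ))|) = W
            field_simp
            ring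
        _ ≤ G x + C₁ * b * ρ ^ (L + 1) := by
            gcongr
            rw [hb]; linarith [hB j]
        _ = G x + s / 2 := by rw [hρL]; field_simp
    have hsub : {x | s < g x} ⊆ {x | ENNReal.ofReal (s / 2) ≤ ENNReal.ofReal (G x)} := fun x hx => by
      have h1 : s < g x := hx
      exact ENNReal.ofReal_le_ofReal (by linarith [hpt x])
    have hGint : Integrable G μ := (hGc.integrableOn_Icc (a := 0) (b := 1)).mono_set
      Ioc_subset_Icc_self
    have hGA : ∫ x, G x ∂μ ≤ C₁ * h / ρ ^ j * ((N + 1) * A) := by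
      simp only [hG]
      rw [integral_const_mul, integral_finsetSum]
      · gcongr
        calc _ ≤ ∑ k ∈ Finset.range (N + 1), A := Finset.sum_le_sum fun k _ => by
              rw [hμ, setIntegral_Ioc_comp_add (w := fun y => |w y|) (fun y => by simp only [hper y])]
              exact hwA
          _ = _ := by simp
      · intro k _
        have hk : Continuous fun x => |w (x + k * (h * ρ))| := by
          have := hw.continuous
          fun_prop
        exact (hk.integrableOn_Icc (a := 0) (b := 1)).mono_set Ioc_subset_Icc_self
    calc μ {x | s < g x} ≤ μ {x | ENNReal.ofReal (s / 2) ≤ ENNReal.ofReal (G x)} :=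
          measure_mono hsub
      _ ≤ (∫⁻ x, ENNReal.ofReal (G x) ∂μ) / ENNReal.ofReal (s / 2) :=
          meas_ge_le_lintegral_div hGc.measurable.ennreal_ofReal.aemeasurable
            (by simpa using hs) ENNReal.ofReal_ne_top
      _ = ENNReal.ofReal ((∫ x, G x ∂μ) / (s / 2)) := by
          rw [← ofReal_integral_eq_lintegral_ofReal hGint (Filter.Eventually.of_forall hG0),
            ENNReal.ofReal_div_of_pos (half_pos hs)]
      _ ≤ ENNReal.ofReal (C₁ * h / ρ ^ j * ((N + 1) * A) / (s / 2)) := by gcongr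
      _ = _ := by
          congr 1
          rw [hρj, Real.div_rpow hs.le (by positivity), hc₁,
            show κ - p = -(1 : ℝ) + -β by rw [hκ]; ring, Real.rpow_add hs, Real.rpow_neg hs.le,
            Real.rpow_neg hs.le, Real.rpow_one]
          field_simp
  have hmain := lintegral_rpow_le_of_distribution_le (μ := μ) hgc.measurable.aemeasurable hg0 hb0
    hgb (by positivity) hκ0 hp0 hdist
  rw [eLpNorm_eq_lintegral_rpow_enorm_toReal (by simpa using hp0) ENNReal.ofReal_ne_top,
    ENNReal.toReal_ofReal hp0.le]
  have hpt : ∀ x, ‖iteratedDeriv j w x‖ₑ ^ p =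
      ENNReal.ofReal (h ^ (-((j + 1 : ℝ) * p))) * ENNReal.ofReal (g x ^ p) := fun x => by
    rw [← ENNReal.ofReal_mul (by positivity), Real.enorm_eq_ofReal_abs,
      ENNReal.ofReal_rpow_of_nonneg (abs_nonneg _) hp0.le]
    congr 1
    simp only [hg]
    rw [Real.mul_rpow (by positivity) (abs_nonneg _), ← Real.rpow_natCast h, ← Real.rpow_mul hh.le,
      ← mul_assoc, ← Real.rpow_add hh]
    push_cast
    simp
  simp_rw [hpt]
  rw [lintegral_const_mul _ (hgc.measurable.pow_const p).ennreal_ofReal]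
  calc _ ≤ (ENNReal.ofReal (h ^ (-((j + 1 : ℝ) * p))) *
        ENNReal.ofReal (p * (c₁ * h * (b ^ κ / κ)))) ^ (1 / p) := by gcongr
    _ = ENNReal.ofReal ((C₂ * (h ^ (-((j + 1 : ℝ) * p)) * h ^ (1 : ℝ))) ^ (1 / p)) := by
        rw [← ENNReal.ofReal_mul (by positivity), ENNReal.ofReal_rpow_of_nonneg (by positivity)
          (by positivity), Real.rpow_one]
        congr 2
        rw [hC₂]; ring
    _ = _ := by
        rw [← Real.rpow_add hh, Real.mul_rpow hC₂0.le (by positivity), ← Real.rpow_mul hh.le]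
        congr 3
        field_simp
        ring

/-! ### Interpolation between `L^1` and `L^∞` and its dual form -/

theorem eLpNorm_le_of_integral_le_of_abs_le {α : Type*} [MeasurableSpace α] {μ : Measure α}
    {g : α → ℝ} (hg : Integrable g μ) {A B : ℝ} (hA0 : 0 < A) (hB0 : 0 < B)
    (hA : ∫ x, |g x| ∂μ ≤ A) (hB : ∀ x, |g x| ≤ B) {p : ℝ≥0∞} (hp : 1 ≤ p) :
    eLpNorm g p μ ≤ ENNReal.ofReal (A ^ (p⁻¹).toReal * B ^ (1 - (p⁻¹).toReal)) := by
  rcases eq_or_ne p ∞ with rfl | hpt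
  · simp only [ENNReal.inv_top, ENNReal.toReal_zero, Real.rpow_zero, sub_zero, Real.rpow_one,
      one_mul, eLpNorm_exponent_top]
    exact eLpNormEssSup_le_of_ae_bound (Filter.Eventually.of_forall hB)
  have hp0 : p ≠ 0 := (zero_lt_one.trans_le hp).ne'
  set P := p.toReal with hP
  have hP1 : 1 ≤ P := by
    rw [hP, ← ENNReal.toReal_one]
    exact ENNReal.toReal_mono hpt hp
  have hP0 : 0 < P := by linarith
  rw [eLpNorm_eq_lintegral_rpow_enorm_toReal hp0 hpt, ENNReal.toReal_inv, ← hP]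
  have h1 : ∫⁻ x, ‖g x‖ₑ ^ P ∂μ ≤ ENNReal.ofReal (B ^ (P - 1) * A) := by
    calc ∫⁻ x, ‖g x‖ₑ ^ P ∂μ ≤ ∫⁻ x, ENNReal.ofReal (B ^ (P - 1) * |g x|) ∂μ := by
          refine lintegral_mono fun x => ?_
          rw [Real.enorm_eq_ofReal_abs, ENNReal.ofReal_rpow_of_nonneg (abs_nonneg _) hP0.le]
          refine ENNReal.ofReal_le_ofReal ?_
          rcases (abs_nonneg (g x)).eq_or_lt with h | h
          · rw [← h, Real.zero_rpow hP0.ne', mul_zero]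
          · have : |g x| ^ P = |g x| ^ (P - 1) * |g x| := by
              rw [← Real.rpow_add_one h.ne', sub_add_cancel]
            rw [this]
            gcongr
            exact hB x
      _ = ENNReal.ofReal (∫ x, B ^ (P - 1) * |g x| ∂μ) := by
          rw [ofReal_integral_eq_lintegral_ofReal (hg.abs.const_mul _)]
          exact Filter.Eventually.of_forall fun x => by positivity
      _ ≤ _ := by
          rw [integral_const_mul]
          gcongr
  calc _ ≤ ENNReal.ofReal (B ^ (P - 1) * A) ^ (1 / P) := by gcongr
    _ = _ := by
        rw [ENNReal.ofReal_rpow_of_nonneg (by positivity) (by positivity),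
          Real.mul_rpow (by positivity) hA0.le, ← Real.rpow_mul hB0.le, one_div, mul_comm]
        congr 3
        field_simp

theorem toReal_inv_mem_Icc {p : ℝ≥0∞} (hp : 1 ≤ p) : (p⁻¹).toReal ∈ Icc (0 : ℝ) 1 := by
  refine ⟨ENNReal.toReal_nonneg, ?_⟩
  rw [← ENNReal.toReal_one]
  exact ENNReal.toReal_mono ENNReal.one_ne_top (ENNReal.inv_le_one.2 hp)

/-- Hölder's inequality with the conjugate norm of `g` interpolated between `L^1` and `L^∞`. A lower
bound for the integral thereby becomes one for `w` in `L^p`. -/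
theorem ofReal_integral_abs_mul_le {α : Type*} [MeasurableSpace α] {μ : Measure α}
    {g w : α → ℝ} (hg : Integrable g μ) (hw : AEStronglyMeasurable w μ)
    (hgw : Integrable (fun x => g x * w x) μ) {A B : ℝ}
    (hA0 : 0 < A) (hB0 : 0 < B) (hA : ∫ x, |g x| ∂μ ≤ A) (hB : ∀ x, |g x| ≤ B) {p : ℝ≥0∞}
    (hp : 1 ≤ p) :
    ENNReal.ofReal (∫ x, |g x * w x| ∂μ) ≤
      ENNReal.ofReal (A ^ (1 - (p⁻¹).toReal) * B ^ (p⁻¹).toReal) * eLpNorm w p μ := by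
  have hc : p.HolderConjugate (ENNReal.conjExponent p) := ENNReal.HolderConjugate.conjExponent hp
  have hc' : ENNReal.HolderConjugate (ENNReal.conjExponent p) p := hc.symm
  have hq1 : 1 ≤ ENNReal.conjExponent p := hc'.one_le
  have hsum : p⁻¹ + (ENNReal.conjExponent p)⁻¹ = 1 := hc.inv_add_inv_eq_one
  have hq : ((ENNReal.conjExponent p)⁻¹).toReal = 1 - (p⁻¹).toReal := by
    have := congrArg ENNReal.toReal hsum
    rw [ENNReal.toReal_add (by simpa using (zero_lt_one.trans_le hp).ne')
      (by simpa using (zero_lt_one.trans_le hq1).ne'), ENNReal.toReal_one] at this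
    linarith
  have h1 : eLpNorm (g • w) 1 μ ≤ eLpNorm g (ENNReal.conjExponent p) μ * eLpNorm w p μ :=
    eLpNorm_smul_le_mul_eLpNorm hw hg.1
  have h2 := eLpNorm_le_of_integral_le_of_abs_le hg hA0 hB0 hA hB hq1
  rw [hq, sub_sub_cancel] at h2
  calc ENNReal.ofReal (∫ x, |g x * w x| ∂μ) = eLpNorm (g • w) 1 μ := by
        rw [eLpNorm_one_eq_lintegral_enorm,
          ofReal_integral_eq_lintegral_ofReal hgw.abs (Filter.Eventually.of_forall fun _ => abs_nonneg _)]
        simp only [Pi.smul_apply', smul_eq_mul, Real.enorm_eq_ofReal_abs]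
    _ ≤ _ := h1.trans (by gcongr)

/-! ### Consequences of the normalisation of the initial value -/

/-- A one-sided slope bound suffices: `w ≤ w x + K` on `[x, x+1]` and `w ≥ w x - K` on `[x-1, x]`,
and `w` has mean zero over each. -/
theorem abs_le_of_periodic_of_deriv_le {w : ℝ → ℝ} (hw : ContDiff ℝ ∞ w)
    (hper : Function.Periodic w 1) (hmean : ∫ x in (0 : ℝ)..1, w x = 0) {K : ℝ} (hK : 0 ≤ K)
    (hd : ∀ x, deriv w x ≤ K) (x : ℝ) : |w x| ≤ K := by
  have hmv : ∀ a b : ℝ, a ≤ b → w b - w a ≤ K * (b - a) := fun a b hab =>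
    image_sub_le_mul_sub_of_deriv_le (hw.differentiable (by simp)) hd hab
  have hint : ∀ c : ℝ, ∫ s in c..c + 1, w s = 0 := fun c => by
    rw [hper.intervalIntegral_add_eq c 0, zero_add, hmean]
  have hwi : ∀ a b, IntervalIntegrable w volume a b := fun a b => hw.continuous.intervalIntegrable _ _
  rw [abs_le]
  constructor
  · have h := intervalIntegral.integral_mono_on (a := x) (b := x + 1) (by linarith) (hwi _ _)
      (continuous_const.intervalIntegrable _ _) (g := fun _ => w x + K) (fun s hs => by
        have := hmv x s hs.1
        nlinarith [hs.2])
    rw [hint] at h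
    simp at h
    linarith
  · have h := intervalIntegral.integral_mono_on (a := x - 1) (b := x - 1 + 1) (by linarith)
      (continuous_const.intervalIntegrable _ _) (hwi _ _) (f := fun _ => w x - K) (fun s hs => by
        have := hmv s x (by linarith [hs.2])
        nlinarith [hs.1])
    rw [hint] at h
    simp at h
    linarith

theorem sobolevNorm_one_eq {w : ℝ → ℝ} (hw : ContDiff ℝ ∞ w) (m : ℕ) :
    sobolevNorm m 1 w = ENNReal.ofReal (∫ x in Ioc (0 : ℝ) 1, |iteratedDeriv m w x|) := by
  have hc := (contDiff_iteratedDeriv hw m).continuous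
  rw [sobolevNorm, eLpNorm_one_eq_lintegral_enorm, ofReal_integral_eq_lintegral_ofReal
    ((hc.abs.integrableOn_Icc (a := 0) (b := 1)).mono_set Ioc_subset_Icc_self)
    (Filter.Eventually.of_forall fun _ => abs_nonneg _)]
  simp only [Real.enorm_eq_ofReal_abs]

theorem abs_deriv_le_of_initialParam {w : ℝ → ℝ} (hw : ContDiff ℝ ∞ w)
    (hper : Function.Periodic w 1) {D : ℝ} (hD : 0 < D) (h : initialParam w ≤ ENNReal.ofReal D)
    (x : ℝ) : |iteratedDeriv 1 w x| ≤ D := by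
  have h1 : sobolevNorm 1 ∞ w ≤ ENNReal.ofReal D := (le_max_right _ _).trans h
  have hc := (contDiff_iteratedDeriv hw 1).continuous
  rw [sobolevNorm, eLpNorm_exponent_top] at h1
  have hae : ∀ᵐ y ∂volume.restrict (Ioc (0 : ℝ) 1), |iteratedDeriv 1 w y| ≤ D := by
    filter_upwards [ae_le_eLpNormEssSup (f := iteratedDeriv 1 w)
      (μ := volume.restrict (Ioc (0 : ℝ) 1))] with y hy
    have := hy.trans h1
    rwa [Real.enorm_eq_ofReal_abs, ENNReal.ofReal_le_ofReal_iff hD.le] at this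
  -- Taking the maximum with `D` turns the almost everywhere inequality into an equality of
  -- continuous functions, which then holds everywhere.
  have hae2 : (fun y => max |iteratedDeriv 1 w y| D) =ᵐ[volume.restrict (Ioc (0 : ℝ) 1)]
      fun _ => D := hae.mono fun y hy => max_eq_right hy
  have heq := Measure.eqOn_Ioc_of_ae_eq volume hae2
    (hc.abs.max continuous_const).continuousOn continuousOn_const
  obtain ⟨y, hy, hxy⟩ := (periodic_iteratedDeriv hper 1).exists_mem_Ioc one_pos x 0
  rw [zero_add] at hy
  rw [hxy]
  exact max_eq_right_iff.1 (heq hy)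

theorem inv_le_integral_of_initialParam {w : ℝ → ℝ} (hw : ContDiff ℝ ∞ w) {D : ℝ} (hD : 0 < D)
    (h : initialParam w ≤ ENNReal.ofReal D) : D⁻¹ ≤ ∫ x in (0 : ℝ)..1, |w x| := by
  have h1 : (sobolevNorm 0 1 w)⁻¹ ≤ ENNReal.ofReal D := (le_max_left _ _).trans h
  rw [ENNReal.inv_le_iff_inv_le, sobolevNorm_one_eq hw, ← ENNReal.ofReal_inv_of_pos hD,
    ENNReal.ofReal_le_ofReal_iff (integral_nonneg fun _ => abs_nonneg _)] at h1
  rw [intervalIntegral.integral_of_le zero_le_one]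
  simpa using h1

namespace IsBurgersSolution

variable {f : ℝ → ℝ} {ν : ℝ} {u : ℝ → ℝ → ℝ}

theorem abs_deriv_zero_le (hu : IsBurgersSolution f ν u) {D : ℝ} (hD : 0 < D)
    (h : initialParam (u 0) = ENNReal.ofReal D) (x : ℝ) : |iteratedDeriv 1 (u 0) x| ≤ D :=
  abs_deriv_le_of_initialParam (hu.contDiff le_rfl) (hu.periodic 0 le_rfl) hD h.le x

theorem abs_zero_le (hu : IsBurgersSolution f ν u) {D : ℝ} (hD : 0 < D)
    (h : initialParam (u 0) = ENNReal.ofReal D) (x : ℝ) : |u 0 x| ≤ D :=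
  abs_le_of_periodic_of_deriv_le (hu.contDiff le_rfl) (hu.periodic 0 le_rfl) hu.mean_zero hD.le
    (fun y => by
      have := hu.abs_deriv_zero_le hD h y
      rw [iteratedDeriv_one] at this
      exact (le_abs_self _).trans this) x

theorem integrableOn (hu : IsBurgersSolution f ν u) {t : ℝ} (ht : 0 ≤ t) (m : ℕ) :
    Integrable (iteratedDeriv m (u t)) (volume.restrict (Ioc (0 : ℝ) 1)) :=
  ((hu.continuous_iteratedDeriv ht m).integrableOn_Icc (a := 0) (b := 1)).mono_set
    Ioc_subset_Icc_self

/-- As `u_x ≤ K` with `K ≥ 0`, one has `|u_x| ≤ 2K - u_x`, and `u_x` integrates to zero. -/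
theorem integral_abs_deriv_le (hu : IsBurgersSolution f ν u) {K t : ℝ} (ht : 0 ≤ t)
    (hK : ∀ x, iteratedDeriv 1 (u t) x ≤ K) :
    ∫ x in Ioc (0 : ℝ) 1, |iteratedDeriv 1 (u t) x| ≤ 2 * K := by
  have h0 := integral_eq_zero_of_hasDerivAt_periodic (hu.periodic t ht) (hu.hasDerivAt_zero ht)
    (hu.continuous_iteratedDeriv ht 1)
  rw [intervalIntegral.integral_of_le zero_le_one] at h0
  have hi := hu.integrableOn ht 1
  have hK0 : 0 ≤ K := by
    obtain h := integral_mono hi (integrable_const K) hK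
    rw [h0] at h
    simpa using h
  calc ∫ x in Ioc (0 : ℝ) 1, |iteratedDeriv 1 (u t) x|
      ≤ ∫ x in Ioc (0 : ℝ) 1, (2 * K - iteratedDeriv 1 (u t) x) := by
        refine integral_mono hi.abs ((integrable_const _).sub hi) fun x => ?_
        exact abs_le.2 ⟨by linarith, by linarith [hK x]⟩
    _ = 2 * K := by
        rw [integral_sub (integrable_const _) hi, h0]
        simp

end IsBurgersSolution

/-! ### Upper bounds -/

theorem gammaExp_zero (p : ℝ≥0∞) : gammaExp 0 p = 0 := by
  simp [gammaExp]

theorem gammaExp_of_one_le {m : ℕ} (hm : 1 ≤ m) {p : ℝ≥0∞} (hp : 1 ≤ p) :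
    gammaExp m p = m - (p⁻¹).toReal := by
  have h1 : (1 : ℝ) ≤ m := by exact_mod_cast hm
  exact max_eq_right (by linarith [(toReal_inv_mem_Icc hp).2])

theorem gammaExp_nonneg (m : ℕ) (p : ℝ≥0∞) : 0 ≤ gammaExp m p := le_max_left _ _

theorem exists_upper_bound {f : ℝ → ℝ} (hf : ContDiff ℝ ∞ f)
    (hconv : ∀ x, 0 ≤ iteratedDeriv 2 f x) {D : ℝ} (hD : 0 < D) (m : ℕ) (p : ℝ≥0∞)
    (hmp : (m ≤ 1 ∧ 1 ≤ p) ∨ (2 ≤ m ∧ 1 < p)) :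
    ∃ C : ℝ, 0 < C ∧ ∀ ν : ℝ, 0 < ν → ν ≤ 1 → ∀ u : ℝ → ℝ → ℝ, IsBurgersSolution f ν u →
      initialParam (u 0) = ENNReal.ofReal D → ∀ h : ℝ, 0 < h → h ≤ ν → ∀ t : ℝ, h ≤ t →
        sobolevNorm m p (u t) ≤ ENNReal.ofReal (C * h ^ (-gammaExp m p)) := by
  have hp : 1 ≤ p := hmp.elim (fun h => h.2) (fun h => h.2.le)
  rcases Nat.lt_or_ge m 1 with hm0 | hm1
  · obtain rfl : m = 0 := by omega
    refine ⟨D, hD, fun ν hν hν1 u hu hi h hh hhν t ht => ?_⟩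
    rw [gammaExp_zero, neg_zero, Real.rpow_zero, mul_one]
    have := eLpNorm_le_of_ae_bound (p := p) (f := iteratedDeriv 0 (u t)) (C := D)
      (μ := volume.restrict (Ioc (0 : ℝ) 1)) (Filter.Eventually.of_forall fun x => by
        simpa using hu.abs_le_of_initial hf hν (hu.abs_zero_le hD hi) (hh.le.trans ht) x)
    simpa [sobolevNorm] using this
  rw [gammaExp_of_one_le hm1 hp]
  rcases Nat.lt_or_ge m 2 with hm1' | hm2
  · obtain rfl : m = 1 := by omega
    obtain ⟨B, hB, H⟩ := exists_pointwise_derivative_bound hf hconv hD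
    have hB0 : 0 < B := by linarith
    refine ⟨(2 * D) ^ (p⁻¹).toReal * B ^ (1 - (p⁻¹).toReal), by positivity,
      fun ν hν hν1 u hu hi h hh hhν t ht => ?_⟩
    have ht0 := hh.le.trans ht
    have h0 := hu.abs_zero_le hD hi
    have h1 := hu.abs_deriv_zero_le hD hi
    refine (eLpNorm_le_of_integral_le_of_abs_le (hu.integrableOn ht0 1) (A := 2 * D) (B := B / h)
      (by positivity) (by positivity) ?_ ?_ hp).trans ?_
    · exact hu.integral_abs_deriv_le ht0
        (hu.deriv_le_of_initial hf hν hconv (fun x => (le_abs_self _).trans (h1 x)) ht0)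
    · exact fun x => (H ν hν hν1 u hu h0 h1 t ht0 x).trans (by gcongr)
    · refine ENNReal.ofReal_le_ofReal (le_of_eq ?_)
      rw [Real.div_rpow hB0.le hh.le, Real.rpow_neg hh.le, mul_assoc, div_eq_mul_inv, Nat.cast_one]
  have hp1 : 1 < p := hmp.elim (fun h => absurd h.1 (by omega)) (fun h => h.2)
  choose B hB H using exists_derivative_bound hf hconv hD
  have hB0 : ∀ i, 0 < B i := fun i => zero_lt_one.trans_le (hB i)
  rcases eq_or_ne p ∞ with rfl | hpt
  · refine ⟨B m ^ m, pow_pos (hB0 m) m, fun ν hν hν1 u hu hi h hh hhν t ht => ?_⟩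
    have h0 := hu.abs_zero_le hD hi
    have h1 := hu.abs_deriv_zero_le hD hi
    rw [sobolevNorm, eLpNorm_exponent_top]
    refine eLpNormEssSup_le_of_ae_bound (Filter.Eventually.of_forall fun x => ?_)
    refine (H m ν hν hν1 u hu h0 h1 h hh hhν t ht x m hm1 (by omega)).trans (le_of_eq ?_)
    rw [div_pow, ENNReal.inv_top, ENNReal.toReal_zero, sub_zero, Real.rpow_neg hh.le,
      Real.rpow_natCast, div_eq_mul_inv]
  · have hP1 : 1 < p.toReal := by
      rw [← ENNReal.toReal_one]
      exact (ENNReal.toReal_lt_toReal ENNReal.one_ne_top hpt).2 hp1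
    obtain ⟨j, rfl⟩ : ∃ j, m = j + 1 := ⟨m - 1, by omega⟩
    -- Here `w = u_x`, so order `i` of `w` is order `i + 1` of `u`; this accounts for the power of
    -- `B i`.
    obtain ⟨C, hC, HC⟩ := exists_eLpNorm_iteratedDeriv_bound j hP1 (2 * D) (by positivity)
      (fun i => B i ^ (i + 1)) (fun i => pow_pos (hB0 i) _)
    refine ⟨C, hC, fun ν hν hν1 u hu hi h hh hhν t ht => ?_⟩
    have ht0 := hh.le.trans ht
    have h0 := hu.abs_zero_le hD hi
    have h1 := hu.abs_deriv_zero_le hD hi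
    have := HC (iteratedDeriv 1 (u t)) (contDiff_iteratedDeriv (hu.contDiff ht0) 1)
      (hu.periodic_deriv ht0 1) h hh (hu.integral_abs_deriv_le ht0
        (hu.deriv_le_of_initial hf hν hconv (fun x => (le_abs_self _).trans (h1 x)) ht0))
      (fun i x => by
        rw [iteratedDeriv_iteratedDeriv, ← div_eq_mul_inv, ← div_pow]
        exact H i ν hν hν1 u hu h0 h1 h hh hhν t ht x (i + 1) (by omega) le_rfl)
    rw [iteratedDeriv_iteratedDeriv, ENNReal.ofReal_toReal hpt] at this
    rw [ENNReal.toReal_inv]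
    simpa [sobolevNorm] using this

/-! ### Lower bounds at a fixed time -/

theorem integrable_restrict_Ioc {g : ℝ → ℝ} (hg : Continuous g) :
    Integrable g (volume.restrict (Ioc (0 : ℝ) 1)) :=
  (hg.integrableOn_Icc (a := 0) (b := 1)).mono_set Ioc_subset_Icc_self

theorem sobolevNorm_two_sq {w : ℝ → ℝ} (hw : ContDiff ℝ ∞ w) (m : ℕ) :
    sobolevNorm m 2 w ^ 2 = ENNReal.ofReal (∫ x in Ioc (0 : ℝ) 1, iteratedDeriv m w x ^ 2) := by
  have hc := (contDiff_iteratedDeriv hw m).continuous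
  rw [sobolevNorm, eLpNorm_eq_lintegral_rpow_enorm_toReal two_ne_zero ENNReal.ofNat_ne_top,
    ofReal_integral_eq_lintegral_ofReal
    (integrable_restrict_Ioc (by fun_prop : Continuous fun x => iteratedDeriv m w x ^ 2))
    (Filter.Eventually.of_forall fun _ => sq_nonneg _), ← ENNReal.rpow_natCast,
    ← ENNReal.rpow_mul]
  simp only [ENNReal.toReal_ofNat, Nat.cast_ofNat, one_div, inv_mul_cancel₀ (two_ne_zero' ℝ),
    ENNReal.rpow_one]
  refine lintegral_congr fun x => ?_
  rw [Real.enorm_eq_ofReal_abs, ENNReal.ofReal_rpow_of_nonneg (abs_nonneg _) zero_le_two,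
    Real.rpow_two, sq_abs]

theorem ofReal_le_of_ofReal_le_mul {X Y Z : ℝ} {S : ℝ≥0∞} (hY : 0 < Y) (h : Z * Y ≤ X)
    (hS : ENNReal.ofReal X ≤ ENNReal.ofReal Y * S) : ENNReal.ofReal Z ≤ S := by
  have hY' : ENNReal.ofReal Y ≠ 0 := by simpa using hY
  rw [← ENNReal.mul_le_mul_iff_right hY' ENNReal.ofReal_ne_top, ← ENNReal.ofReal_mul hY.le,
    mul_comm Y]
  exact (ENNReal.ofReal_le_ofReal h).trans hS

/-- Integrate `(w³)' = 3 w² w'` from a zero of `w`. The cube is what puts the weight `w²` in the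
integral; its `L^1` norm is governed by the `L^2` norm of `w`, for which sharp upper bounds hold at
every order, unlike the `L^1` norm. -/
theorem abs_pow_three_le_integral {w : ℝ → ℝ} (hw : ContDiff ℝ ∞ w) (hper : Function.Periodic w 1)
    {y : ℝ} (hy : w y = 0) (x : ℝ) :
    |w x| ^ 3 ≤ 3 * ∫ s in Ioc (0 : ℝ) 1, |w s ^ 2 * deriv w s| := by
  obtain ⟨z, hz, hxz⟩ := hper.exists_mem_Ico one_pos x y
  rw [hxz]
  have hdc : Continuous (deriv w) := hw.continuous_deriv (by simp)
  have hwc := hw.continuous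
  have hdper : Function.Periodic (deriv w) 1 := by
    simpa only [iteratedDeriv_one] using periodic_iteratedDeriv hper 1
  have hftc : ∫ s in y..z, 3 * (w s ^ 2 * deriv w s) = w z ^ 3 := by
    rw [intervalIntegral.integral_eq_sub_of_hasDerivAt (f := fun s => w s ^ 3), hy]
    · ring
    · intro s _
      exact ((hw.differentiable (by simp) s).hasDerivAt.pow 3).congr_deriv (by push_cast; ring)
    · exact Continuous.intervalIntegrable (by fun_prop) _ _
  have hper' : ∫ s in y..(y + 1), |w s ^ 2 * deriv w s| =
      ∫ s in (0 : ℝ)..1, |w s ^ 2 * deriv w s| := by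
    have hp : Function.Periodic (fun s => |w s ^ 2 * deriv w s|) 1 := fun s => by
      simp only [hper s, hdper s]
    have := hp.intervalIntegral_add_eq y 0
    rwa [zero_add] at this
  rw [← intervalIntegral.integral_of_le zero_le_one, ← hper', ← abs_pow, ← hftc,
    intervalIntegral.integral_const_mul, abs_mul, abs_of_pos (by norm_num : (0 : ℝ) < 3)]
  gcongr
  calc |∫ s in y..z, w s ^ 2 * deriv w s| ≤ ∫ s in y..z, |w s ^ 2 * deriv w s| :=
        intervalIntegral.abs_integral_le_integral_abs hz.1
    _ ≤ ∫ s in y..(y + 1), |w s ^ 2 * deriv w s| := by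
        refine intervalIntegral.integral_mono_interval le_rfl hz.1 hz.2.le
          (Filter.Eventually.of_forall fun s => abs_nonneg _)
          (Continuous.intervalIntegrable (by fun_prop) _ _)

theorem exists_deriv_eq_zero_of_periodic {w : ℝ → ℝ} (hw : ContDiff ℝ ∞ w)
    (hper : Function.Periodic w 1) : ∃ y, deriv w y = 0 := by
  obtain ⟨y, _, hy⟩ := exists_deriv_eq_zero (f := w) zero_lt_one hw.continuous.continuousOn
    (by have := hper 0; rw [zero_add] at this; exact this.symm)
  exact ⟨y, hy⟩

theorem exists_le_abs_of_le_sobolevNorm_top {w : ℝ → ℝ} {m : ℕ} {L : ℝ} (hL : 0 < L)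
    (h : ENNReal.ofReal L ≤ sobolevNorm m ∞ w) : ∃ x, L / 2 ≤ |iteratedDeriv m w x| := by
  by_contra! hlt
  have h2 : sobolevNorm m ∞ w ≤ ENNReal.ofReal (L / 2) := by
    rw [sobolevNorm, eLpNorm_exponent_top]
    exact eLpNormEssSup_le_of_ae_bound (Filter.Eventually.of_forall fun x => (hlt x).le)
  have := (ENNReal.ofReal_le_ofReal_iff (by linarith)).1 (h.trans h2)
  linarith

/-- Induction on the order, by duality. At order one, `∫ u_x²` is bounded by Hölder's inequality. At
later orders, the supremum of `v = ∂^(k+1) u` bounds `∫ v² |v'|` below, and `v²` is controlled in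
`L^1` and `L^∞`; only the case `p = ∞` of the previous order is used. -/
theorem exists_lower_bound_of_le_integral_sq {f : ℝ → ℝ} (hf : ContDiff ℝ ∞ f)
    (hconv : ∀ x, 0 ≤ iteratedDeriv 2 f x) {D : ℝ} (hD : 0 < D) {c₀ : ℝ} (hc₀ : 0 < c₀) (k : ℕ)
    (p : ℝ≥0∞) (hp : 1 ≤ p) :
    ∃ c : ℝ, 0 < c ∧ ∀ ν : ℝ, 0 < ν → ν ≤ 1 → ∀ u : ℝ → ℝ → ℝ, IsBurgersSolution f ν u →
      initialParam (u 0) = ENNReal.ofReal D → ∀ h : ℝ, 0 < h → h ≤ ν → ∀ t : ℝ, h ≤ t →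
        c₀ / h ≤ ∫ x in (0 : ℝ)..1, iteratedDeriv 1 (u t) x ^ 2 →
        ENNReal.ofReal (c * h ^ (-gammaExp (k + 1) p)) ≤ sobolevNorm (k + 1) p (u t) := by
  induction k generalizing p with
  | zero =>
    obtain ⟨B, hB, H⟩ := exists_pointwise_derivative_bound hf hconv hD
    have hB0 : 0 < B := by linarith
    set q := (p⁻¹).toReal with hq
    refine ⟨c₀ / ((2 * D) ^ (1 - q) * B ^ q), by positivity,
      fun ν hν hν1 u hu hi h hh hhν t ht hlow => ?_⟩
    have ht0 := hh.le.trans ht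
    have h0 := hu.abs_zero_le hD hi
    have h1 := hu.abs_deriv_zero_le hD hi
    rw [gammaExp_of_one_le le_rfl hp, ← hq]
    have hc1 := hu.continuous_iteratedDeriv ht0 1
    have hdual := ofReal_integral_abs_mul_le (hu.integrableOn ht0 1)
      (hu.integrableOn ht0 1).1 (integrable_restrict_Ioc (hc1.mul hc1)) (A := 2 * D) (B := B / h) (by positivity) (by positivity)
      (hu.integral_abs_deriv_le ht0
        (hu.deriv_le_of_initial hf hν hconv (fun x => (le_abs_self _).trans (h1 x)) ht0))
      (fun x => (H ν hν hν1 u hu h0 h1 t ht0 x).trans (by gcongr)) hp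
    refine ofReal_le_of_ofReal_le_mul (by positivity) ?_ hdual
    simp only [abs_mul_abs_self, abs_mul]
    rw [← intervalIntegral.integral_of_le zero_le_one]
    refine le_trans (le_of_eq ?_) (hlow.trans (le_of_eq (by simp only [sq])))
    rw [← hq, Real.div_rpow hB0.le hh.le, Nat.cast_one,
      show -(1 - q) = q - 1 by ring, Real.rpow_sub_one hh.ne']
    field_simp
  | succ k ih =>
    obtain ⟨c, hc, IH⟩ := ih ∞ le_top
    obtain ⟨B, hB, H⟩ := exists_derivative_bound hf hconv hD k
    obtain ⟨C, hC, HC⟩ := exists_upper_bound hf hconv hD (k + 1) 2 (by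
      rcases Nat.eq_zero_or_pos k with rfl | hk
      · exact Or.inl ⟨le_rfl, one_le_two⟩
      · exact Or.inr ⟨by omega, ENNReal.one_lt_two⟩)
    have hB0 : 0 < B := by linarith
    set q := (p⁻¹).toReal with hq
    refine ⟨(c / 2) ^ 3 / 3 / ((C ^ 2) ^ (1 - q) * ((B ^ (k + 1)) ^ 2) ^ q), by positivity,
      fun ν hν hν1 u hu hi h hh hhν t ht hlow => ?_⟩
    have ht0 := hh.le.trans ht
    have h0 := hu.abs_zero_le hD hi
    have h1 := hu.abs_deriv_zero_le hD hi
    have hsup := IH ν hν hν1 u hu hi h hh hhν t ht hlow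
    obtain ⟨x, hx⟩ := exists_le_abs_of_le_sobolevNorm_top (by positivity) hsup
    have hγ : gammaExp (k + 1) ∞ = (k + 1 : ℕ) := by
      rw [gammaExp_of_one_le (by omega) le_top]; simp
    rw [hγ, Real.rpow_neg hh.le, Real.rpow_natCast] at hx
    have hvC := contDiff_iteratedDeriv (hu.contDiff ht0) (k + 1)
    obtain ⟨y, hy⟩ : ∃ y, iteratedDeriv (k + 1) (u t) y = 0 := by
      rw [iteratedDeriv_succ]
      exact exists_deriv_eq_zero_of_periodic (contDiff_iteratedDeriv (hu.contDiff ht0) k)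
        (hu.periodic_deriv ht0 k)
    have hcube := abs_pow_three_le_integral hvC (hu.periodic_deriv ht0 (k + 1)) hy x
    rw [← iteratedDeriv_succ] at hcube
    have hA : ∫ x in Ioc (0 : ℝ) 1, |iteratedDeriv (k + 1) (u t) x ^ 2| ≤
        C ^ 2 * h ^ (-((2 * k + 1 : ℕ) : ℝ)) := by
      have e := HC ν hν hν1 u hu hi h hh hhν t ht
      have e2 : sobolevNorm (k + 1) 2 (u t) ^ 2 ≤
          ENNReal.ofReal (C * h ^ (-gammaExp (k + 1) 2)) ^ 2 := by gcongr
      rw [sobolevNorm_two_sq (hu.contDiff ht0), ← ENNReal.ofReal_pow (by positivity),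
        ENNReal.ofReal_le_ofReal_iff (by positivity), mul_pow, ← Real.rpow_mul_natCast hh.le] at e2
      simp only [abs_pow, sq_abs]
      refine e2.trans (le_of_eq ?_)
      rw [gammaExp_of_one_le (by omega) one_le_two, ENNReal.toReal_inv]
      congr 2
      push_cast
      simp
      ring
    have hvc := hvC.continuous
    have hvc2 := hu.continuous_iteratedDeriv ht0 (k + 2)
    have hdual := ofReal_integral_abs_mul_le (μ := volume.restrict (Ioc (0 : ℝ) 1))
      (g := fun x => iteratedDeriv (k + 1) (u t) x ^ 2) (w := iteratedDeriv (k + 2) (u t))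
      (integrable_restrict_Ioc (by fun_prop))
      hvc2.aestronglyMeasurable
      (integrable_restrict_Ioc (by fun_prop)) (A := C ^ 2 * h ^ (-((2 * k + 1 : ℕ) : ℝ))) (B := ((B / h) ^ (k + 1)) ^ 2)
      (by positivity) (by positivity) hA
      (fun x => by
        rw [abs_pow]
        gcongr
        exact H ν hν hν1 u hu h0 h1 h hh hhν t ht x (k + 1) (by omega) le_rfl) hp
    refine ofReal_le_of_ofReal_le_mul (by positivity) ?_ hdual
    have hx3 : (c * (h ^ (k + 1))⁻¹ / 2) ^ 3 ≤ |iteratedDeriv (k + 1) (u t) x| ^ 3 := by gcongr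
    refine le_trans (le_of_eq ?_)
      (show (c * (h ^ (k + 1))⁻¹ / 2) ^ 3 / 3 ≤ _ by linarith)
    rw [gammaExp_of_one_le (by omega) hp, ← hq, Real.mul_rpow (by positivity) (by positivity),
      ← Real.rpow_mul hh.le]
    have e1 : (((B / h) ^ (k + 1)) ^ 2) ^ q = ((B ^ (k + 1)) ^ 2) ^ q * h ^ (-(2 * (k + 1) * q)) := by
      rw [div_pow, div_pow, Real.div_rpow (by positivity) (by positivity), ← pow_mul h,
        ← Real.rpow_natCast h, ← Real.rpow_mul hh.le, Real.rpow_neg hh.le, div_eq_mul_inv]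
      congr 3
      push_cast
      ring
    have e2 : (c * (h ^ (k + 1))⁻¹ / 2) ^ 3 / 3 = (c / 2) ^ 3 / 3 * h ^ (-(3 * (k + 1)) : ℝ) := by
      rw [Real.rpow_neg hh.le, show (3 * (k + 1) : ℝ) = ((3 * (k + 1) : ℕ) : ℝ) by push_cast; ring,
        Real.rpow_natCast]
      field_simp
      ring
    rw [e1, e2]
    -- The powers of `h` balance exactly, so the constant does not depend on `h`.
    have e3 : h ^ (-(((k + 1 + 1 : ℕ) : ℝ) - q)) * (h ^ (-((2 * k + 1 : ℕ) : ℝ) * (1 - q)) *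
        h ^ (-(2 * (k + 1) * q))) = h ^ (-(3 * (k + 1)) : ℝ) := by
      rw [← Real.rpow_add hh, ← Real.rpow_add hh]
      congr 1
      push_cast
      ring
    rw [← e3]
    have n1 : ((C ^ 2) ^ (1 - q)) ≠ 0 := by positivity
    have n2 : (((B ^ (k + 1)) ^ 2) ^ q) ≠ 0 := by positivity
    generalize (C ^ 2) ^ (1 - q) = X at *
    generalize ((B ^ (k + 1)) ^ 2) ^ q = Y at *
    field_simp

/-! ### Energy decay and the set of good times -/

/-- The variance of `|w|` over the period is nonnegative. -/
theorem sq_integral_abs_le {w : ℝ → ℝ} (hw : Continuous w) :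
    (∫ x in (0 : ℝ)..1, |w x|) ^ 2 ≤ ∫ x in (0 : ℝ)..1, w x ^ 2 := by
  set a := ∫ x in (0 : ℝ)..1, |w x| with ha
  have h1 : 0 ≤ ∫ x in (0 : ℝ)..1, (|w x| - a) ^ 2 :=
    intervalIntegral.integral_nonneg zero_le_one fun _ _ => sq_nonneg _
  have h2 : ∫ x in (0 : ℝ)..1, (|w x| - a) ^ 2 =
      (∫ x in (0 : ℝ)..1, w x ^ 2) - 2 * a * a + a ^ 2 := by
    have : ∀ x, (|w x| - a) ^ 2 = w x ^ 2 - 2 * a * |w x| + a ^ 2 := fun x => by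
      rw [sub_sq, sq_abs]; ring
    simp_rw [this]
    rw [intervalIntegral.integral_add (Continuous.intervalIntegrable (by fun_prop) _ _)
      (Continuous.intervalIntegrable (by fun_prop) _ _),
      intervalIntegral.integral_sub (Continuous.intervalIntegrable (by fun_prop) _ _)
      (Continuous.intervalIntegrable (by fun_prop) _ _), intervalIntegral.integral_const_mul, ← ha]
    simp
  nlinarith

/-- If a function bounded by `K` has integral at least `e`, then it is not small on a large set. -/
theorem le_volume_of_le_integral {g : ℝ → ℝ} {a b K e : ℝ} (hab : a < b)
    (hg : ContinuousOn g (Icc a b)) (hK0 : 0 < K) (he : 0 < e) (hK : ∀ t ∈ Icc a b, g t ≤ K)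
    (hint : e ≤ ∫ t in a..b, g t) :
    MeasurableSet (Icc a b ∩ g ⁻¹' Ici (e / (2 * (b - a)))) ∧
      ENNReal.ofReal (e / (2 * K)) ≤ volume (Icc a b ∩ g ⁻¹' Ici (e / (2 * (b - a)))) := by
  set c := e / (2 * (b - a)) with hc
  have hba : 0 < b - a := by linarith
  set G := Icc a b ∩ g ⁻¹' Ici c with hG
  have hGm : MeasurableSet G := (hg.preimage_isClosed_of_isClosed isClosed_Icc isClosed_Ici).measurableSet
  refine ⟨hGm, ?_⟩
  have hGfin : volume G ≠ ⊤ := ((measure_mono inter_subset_left).trans_lt measure_Icc_lt_top).ne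
  -- With `g ≤ K` on `G` and `g ≤ c` off it, `e ≤ K |G| + c (b - a)`; the last term is `e / 2` by
  -- the choice of `c`.
  have hle : ∫ t in Icc a b, g t ≤ ∫ t in Icc a b, (G.indicator (fun _ => K) t + c) := by
    refine setIntegral_mono_on hg.integrableOn_Icc ?_ measurableSet_Icc fun t ht => ?_
    · exact ((integrable_const K).indicator hGm).add (integrable_const c)
    · by_cases h : t ∈ G
      · rw [indicator_of_mem h]
        have : 0 < c := by positivity
        linarith [hK t ht]
      · rw [indicator_of_notMem h, zero_add]
        by_contra! hlt
        exact h ⟨ht, hlt.le⟩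
  rw [integral_add ((integrable_const K).indicator hGm) (integrable_const c),
    integral_indicator hGm, Measure.restrict_restrict hGm, inter_eq_left.2 inter_subset_left,
    setIntegral_const, setIntegral_const, Real.volume_real_Icc_of_le hab.le, smul_eq_mul,
    smul_eq_mul] at hle
  rw [intervalIntegral.integral_of_le hab.le, ← integral_Icc_eq_integral_Ioc] at hint
  have h3 : (b - a) * c = e / 2 := by rw [hc]; field_simp
  rw [ENNReal.ofReal_le_iff_le_toReal hGfin, div_le_iff₀ (by positivity)]
  rw [Measure.real] at hle
  linarith

namespace IsBurgersSolution

variable {f : ℝ → ℝ} {ν : ℝ} {u : ℝ → ℝ → ℝ}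

theorem dissipation_le (hu : IsBurgersSolution f ν u) (hν : 0 < ν) {t K : ℝ} (ht : 0 ≤ t)
    (hK : 0 < K) (h : sobolevNorm 1 2 (u t) ^ 2 ≤ ENNReal.ofReal (K * ν⁻¹)) :
    ν * ∫ x in (0 : ℝ)..1, iteratedDeriv 1 (u t) x ^ 2 ≤ K := by
  rw [sobolevNorm_two_sq (hu.contDiff ht), ENNReal.ofReal_le_ofReal_iff (by positivity),
    ← intervalIntegral.integral_of_le zero_le_one] at h
  calc _ ≤ ν * (K * ν⁻¹) := by gcongr
    _ = K := by field_simp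

theorem continuousOn_dissipation (hu : IsBurgersSolution f ν u) :
    ContinuousOn (fun t => ν * ∫ x in (0 : ℝ)..1, iteratedDeriv 1 (u t) x ^ 2) (Ici 0) :=
  continuousOn_const.mul (continuousOn_integral_slice
    (Q := fun t x => iteratedDeriv 1 (u t) x ^ 2) ((hu.continuousOn_iteratedDeriv 1).pow 2))

/-- The initial energy is at least `|u₀|_1² ≥ D⁻²`, and it is dissipated at rate at most `2K`. -/
theorem le_integral_sq (hu : IsBurgersSolution f ν u) (hf : ContDiff ℝ ∞ f) {D K : ℝ} (hD : 0 < D)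
    (hi : initialParam (u 0) = ENNReal.ofReal D)
    (hK : ∀ t, 0 ≤ t → ν * ∫ x in (0 : ℝ)..1, iteratedDeriv 1 (u t) x ^ 2 ≤ K) {t : ℝ}
    (ht : 0 ≤ t) : (D ^ 2)⁻¹ - 2 * K * t ≤ ∫ x in (0 : ℝ)..1, u t x ^ 2 := by
  have h0 : (D ^ 2)⁻¹ ≤ ∫ x in (0 : ℝ)..1, u 0 x ^ 2 := by
    have h1 := inv_le_integral_of_initialParam (hu.contDiff le_rfl) hD hi.le
    rw [← inv_pow]
    exact (pow_le_pow_left₀ (inv_pos.2 hD).le h1 2).trans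
      (sq_integral_abs_le (hu.contDiff le_rfl).continuous)
  have he := hu.integral_sq_sub hf le_rfl ht
  rw [intervalIntegral.integral_const_mul] at he
  have hb := intervalIntegral.integral_mono_on (μ := volume) ht
    (ContinuousOn.intervalIntegrable (by
      rw [uIcc_of_le ht]; exact hu.continuousOn_dissipation.mono Icc_subset_Ici_self))
    (continuous_const.intervalIntegrable 0 t) (g := fun _ => K) (fun s hs => hK s hs.1)
  rw [intervalIntegral.integral_const, sub_zero, smul_eq_mul] at hb
  linarith

/-- Oleinik's estimate is a one-sided slope bound, which for a mean-zero function bounds the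
supremum. -/
theorem integral_sq_le (hu : IsBurgersSolution f ν u) (hf : ContDiff ℝ ∞ f) (hν : 0 < ν) {σ : ℝ}
    (hσ : 0 < σ) (hconv : ∀ x, σ ≤ iteratedDeriv 2 f x) {t : ℝ} (ht : 0 < t) :
    ∫ x in (0 : ℝ)..1, u t x ^ 2 ≤ (σ⁻¹ / t) ^ 2 := by
  have h := abs_le_of_periodic_of_deriv_le (hu.contDiff ht.le) (hu.periodic t ht.le)
    (hu.integral_eq_zero hf ht.le) (K := σ⁻¹ / t) (by positivity) (fun x => by
      rw [le_div_iff₀ ht, mul_comm, ← iteratedDeriv_one]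
      exact hu.mul_deriv_le hf hν hσ hconv ht.le x)
  have hc := (hu.contDiff ht.le).continuous
  have := intervalIntegral.integral_mono_on zero_le_one
    (Continuous.intervalIntegrable (by fun_prop) _ _)
    (continuous_const.intervalIntegrable 0 1) (f := fun x => u t x ^ 2)
    (g := fun _ => (σ⁻¹ / t) ^ 2) (μ := volume) (fun s hs => by
      rw [← sq_abs]
      exact pow_le_pow_left₀ (abs_nonneg _) (h s) 2)
  simpa using this

end IsBurgersSolution

/-! ### Time averages -/

theorem timeOne_pos {D K : ℝ} (hD : 0 < D) (hK : 0 < K) : 0 < timeOne D K := by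
  unfold timeOne; positivity

theorem timeOne_lt_timeTwo (σ : ℝ) {D K : ℝ} (hD : 0 < D) (hK : 0 < K) :
    timeOne D K < timeTwo σ D K := by
  have := timeOne_pos hD hK
  exact lt_of_lt_of_le (by linarith) (le_max_left _ _)

theorem averagedNorm_le {σ D K α U : ℝ} {m : ℕ} {p : ℝ≥0∞} {u : ℝ → ℝ → ℝ} (hD : 0 < D)
    (hK : 0 < K) (hα : 0 < α)
    (h : ∀ t ∈ Icc (timeOne D K) (timeTwo σ D K), sobolevNorm m p (u t) ≤ ENNReal.ofReal U) :
    averagedNorm σ D K m p α u ≤ ENNReal.ofReal U := by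
  have hT := timeOne_lt_timeTwo σ hD hK
  have hT' : 0 < timeTwo σ D K - timeOne D K := by linarith
  rw [averagedNorm, timeAverage, one_div, ENNReal.rpow_inv_le_iff hα]
  refine ENNReal.div_le_of_le_mul ?_
  calc _ ≤ ∫⁻ t in Icc (timeOne D K) (timeTwo σ D K), ENNReal.ofReal U ^ α := by
        refine setLIntegral_mono' measurableSet_Icc fun t ht => ?_
        gcongr
        exact h t ht
    _ = _ := by rw [setLIntegral_const, Real.volume_Icc]

/-- A lower bound on a set of times of measure at least `δ` is enough for every `α > 0`: the average
loses only a factor depending on `δ`, the interval and `α`. -/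
theorem le_averagedNorm {σ D K α L δ : ℝ} {m : ℕ} {p : ℝ≥0∞} {u : ℝ → ℝ → ℝ} (hD : 0 < D)
    (hK : 0 < K) (hα : 0 < α) (hL : 0 ≤ L) (hδ : 0 ≤ δ) {G : Set ℝ} (hG : MeasurableSet G)
    (hGT : G ⊆ Icc (timeOne D K) (timeTwo σ D K)) (hGδ : ENNReal.ofReal δ ≤ volume G)
    (h : ∀ t ∈ G, ENNReal.ofReal L ≤ sobolevNorm m p (u t)) :
    ENNReal.ofReal ((δ / (timeTwo σ D K - timeOne D K)) ^ (1 / α) * L) ≤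
      averagedNorm σ D K m p α u := by
  have hT := timeOne_lt_timeTwo σ hD hK
  have hT' : 0 < timeTwo σ D K - timeOne D K := by linarith
  rw [averagedNorm, timeAverage, one_div, ENNReal.le_rpow_inv_iff hα,
    ENNReal.ofReal_rpow_of_nonneg (by positivity) hα.le,
    Real.mul_rpow (by positivity) hL, ← Real.rpow_mul (by positivity), inv_mul_cancel₀ hα.ne',
    Real.rpow_one, div_mul_eq_mul_div, ENNReal.ofReal_div_of_pos hT']
  gcongr
  calc ENNReal.ofReal (δ * L ^ α) = ENNReal.ofReal L ^ α * ENNReal.ofReal δ := by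
        rw [ENNReal.ofReal_mul hδ, ENNReal.ofReal_rpow_of_nonneg hL hα.le, mul_comm]
    _ ≤ ENNReal.ofReal L ^ α * volume G := by gcongr
    _ = ∫⁻ _ in G, ENNReal.ofReal L ^ α := by rw [setLIntegral_const]
    _ ≤ ∫⁻ t in G, sobolevNorm m p (u t) ^ α := by
        refine setLIntegral_mono' hG fun t ht => ?_
        gcongr
        exact h t ht
    _ ≤ _ := lintegral_mono_set hGT

/-! ### The energy constant, averaged lower bounds and the main theorem -/

theorem exists_isH1Constant {f : ℝ → ℝ} (hf : ContDiff ℝ ∞ f)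
    (hconv : ∀ x, 0 ≤ iteratedDeriv 2 f x) {D : ℝ} (hD : 0 < D) :
    ∃ K : ℝ, 0 < K ∧ IsH1Constant f D K := by
  obtain ⟨B, hB, H⟩ := exists_pointwise_derivative_bound hf hconv hD
  have hB0 : 0 < B := by linarith
  refine ⟨B * (2 * D), by positivity, fun ν hν hν1 u hu hi t ht => ?_⟩
  have h0 := hu.abs_zero_le hD hi
  have h1 := hu.abs_deriv_zero_le hD hi
  have hc := hu.continuous_iteratedDeriv ht 1
  have hi1 := hu.integrableOn ht 1
  rw [sobolevNorm_two_sq (hu.contDiff ht)]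
  refine ENNReal.ofReal_le_ofReal ?_
  -- One factor `u_x` is bounded by `B / ν`, the other in `L^1` by `2 * D`.
  calc ∫ x in Ioc (0 : ℝ) 1, iteratedDeriv 1 (u t) x ^ 2
      ≤ ∫ x in Ioc (0 : ℝ) 1, B / ν * |iteratedDeriv 1 (u t) x| := by
        refine integral_mono (integrable_restrict_Ioc (by fun_prop)) (hi1.abs.const_mul _) fun x => ?_
        simp only
        rw [← sq_abs, sq]
        gcongr
        exact H ν hν hν1 u hu h0 h1 t ht x
    _ ≤ B / ν * (2 * D) := by
        rw [integral_const_mul]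
        gcongr
        exact hu.integral_abs_deriv_le ht
          (hu.deriv_le_of_initial hf hν hconv (fun x => (le_abs_self _).trans (h1 x)) ht)
    _ = _ := by ring

theorem exists_averagedNorm_lower_bound {f : ℝ → ℝ} (hf : ContDiff ℝ ∞ f) {σ : ℝ} (hσ : 0 < σ)
    (hconv : ∀ x, σ ≤ iteratedDeriv 2 f x) {D : ℝ} (hD : 0 < D) {K : ℝ} (hK : 0 < K)
    (hH1 : IsH1Constant f D K) (m : ℕ) (p : ℝ≥0∞) (hp : 1 ≤ p) {α : ℝ} (hα : 0 < α) :
    ∃ c : ℝ, 0 < c ∧ ∀ ν : ℝ, 0 < ν → ν ≤ 1 → ∀ u : ℝ → ℝ → ℝ, IsBurgersSolution f ν u →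
      initialParam (u 0) = ENNReal.ofReal D →
        ENNReal.ofReal (c * ν ^ (-gammaExp m p)) ≤ averagedNorm σ D K m p α u := by
  have hconv0 : ∀ x, 0 ≤ iteratedDeriv 2 f x := fun x => hσ.le.trans (hconv x)
  set T₁ := timeOne D K with hT₁
  set T₂ := timeTwo σ D K with hT₂
  have hT₁0 : 0 < T₁ := timeOne_pos hD hK
  have hT : T₁ < T₂ := timeOne_lt_timeTwo σ hD hK
  have hT' : 0 < T₂ - T₁ := by linarith
  have hT32 : 3 / 2 * T₁ ≤ T₂ := le_max_left _ _
  have hTσ : 2 * D * σ⁻¹ ≤ T₂ := le_max_right _ _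
  have hKT : 4 * K * T₁ = (D ^ 2)⁻¹ := by rw [hT₁, timeOne]; field_simp
  have hdiss : ∀ ν : ℝ, 0 < ν → ν ≤ 1 → ∀ u : ℝ → ℝ → ℝ, IsBurgersSolution f ν u →
      initialParam (u 0) = ENNReal.ofReal D → ∀ t, 0 ≤ t →
      ν * ∫ x in (0 : ℝ)..1, iteratedDeriv 1 (u t) x ^ 2 ≤ K := fun ν hν hν1 u hu hi t ht =>
    hu.dissipation_le hν ht hK (hH1 ν hν hν1 u hu hi t ht)
  have hD2 : 0 < (D ^ 2)⁻¹ := by positivity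
  rcases Nat.eq_zero_or_pos m with rfl | hm
  -- On `[T₁, 3T₁/2]` the energy is still at least `D⁻² - 3 K T₁ = D⁻² / 4`; the lower bound `3T₁/2
  -- ≤ T₂` keeps this interval inside the averaging interval.
  · refine ⟨((1 / 2 * T₁) / (T₂ - T₁)) ^ (1 / α) * ((D ^ 2)⁻¹ / 4 / D), by positivity,
      fun ν hν hν1 u hu hi => ?_⟩
    rw [gammaExp_zero, neg_zero, Real.rpow_zero, mul_one]
    refine le_averagedNorm hD hK hα (by positivity) (by positivity)
      (measurableSet_Icc : MeasurableSet (Icc T₁ (3 / 2 * T₁))) (Icc_subset_Icc le_rfl hT32) ?_ ?_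
    · rw [Real.volume_Icc]
      exact ENNReal.ofReal_le_ofReal (by linarith)
    · intro t ht
      have ht0 : 0 ≤ t := hT₁0.le.trans ht.1
      have hE := hu.le_integral_sq hf hD hi (hdiss ν hν hν1 u hu hi) ht0
      have hsup := hu.abs_le_of_initial hf hν (hu.abs_zero_le hD hi) ht0
      have hc := (hu.contDiff ht0).continuous
      have hint := hu.integrableOn ht0 0
      rw [iteratedDeriv_zero] at hint
      have hA : ∫ x in Ioc (0 : ℝ) 1, |u t x| ≤ D := by
        have := integral_mono hint.abs (integrable_const D) hsup
        simpa using this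
      have hdual := ofReal_integral_abs_mul_le hint hint.1
        (integrable_restrict_Ioc (hc.mul hc))
        hD hD hA hsup hp
      rw [sobolevNorm, iteratedDeriv_zero]
      refine ofReal_le_of_ofReal_le_mul (by positivity) ?_ hdual
      simp only [abs_mul_abs_self, abs_mul]
      rw [← Real.rpow_add hD, sub_add_cancel, Real.rpow_one,
        ← intervalIntegral.integral_of_le zero_le_one]
      simp only [← sq]
      rw [div_mul_cancel₀ _ hD.ne']
      have : 2 * K * t ≤ 2 * K * (3 / 2 * T₁) := by gcongr; exact ht.2
      linarith
  · obtain ⟨k, rfl⟩ : ∃ k, m = k + 1 := ⟨m - 1, by omega⟩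
    -- The energy falls from at least `D⁻² / 2` at `T₁` to at most `D⁻² / 4` at `T₂`, and the drop
    -- is twice the integrated dissipation.
    set e := (D ^ 2)⁻¹ / 8 with he
    have he0 : 0 < e := by positivity
    -- With `h = δ ν`, both `h ≤ ν` and `h ≤ T₁ ≤ t` hold. The factor `δ` in `c₀` cancels that in
    -- `h`.
    set δ := min 1 T₁ with hδ
    have hδ0 : 0 < δ := lt_min one_pos hT₁0
    obtain ⟨c, hc, H⟩ := exists_lower_bound_of_le_integral_sq hf hconv0 hD
      (c₀ := δ * (e / (2 * (T₂ - T₁)))) (by positivity) k p hp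
    refine ⟨(e / (2 * K) / (T₂ - T₁)) ^ (1 / α) * c, by positivity,
      fun ν hν hν1 u hu hi => ?_⟩
    set g : ℝ → ℝ := fun t => ν * ∫ x in (0 : ℝ)..1, iteratedDeriv 1 (u t) x ^ 2 with hg
    have hint : e ≤ ∫ t in T₁..T₂, g t := by
      have e1 := hu.le_integral_sq hf hD hi (hdiss ν hν hν1 u hu hi) hT₁0.le
      have e2 := hu.integral_sq_le hf hν hσ hconv (hT₁0.trans hT)
      have e3 := hu.integral_sq_sub hf hT₁0.le hT.le
      rw [intervalIntegral.integral_const_mul] at e3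
      have e4 : (σ⁻¹ / T₂) ^ 2 ≤ (D ^ 2)⁻¹ / 4 := by
        have : σ⁻¹ / T₂ ≤ D⁻¹ / 2 := by
          rw [div_le_iff₀ (hT₁0.trans hT)]
          calc σ⁻¹ = D⁻¹ / 2 * (2 * D * σ⁻¹) := by field_simp
            _ ≤ _ := by gcongr
        calc (σ⁻¹ / T₂) ^ 2 ≤ (D⁻¹ / 2) ^ 2 := by
              have := hT₁0.trans hT
              gcongr
          _ = _ := by rw [div_pow, inv_pow]; norm_num
      simp only [hg, he]
      linarith
    obtain ⟨hGm, hGv⟩ := le_volume_of_le_integral (g := g) hT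
      (hu.continuousOn_dissipation.mono (Icc_subset_Ici_self.trans (Ici_subset_Ici.2 hT₁0.le)))
      hK he0 (fun t ht => hdiss ν hν hν1 u hu hi t (hT₁0.le.trans ht.1)) hint
    rw [mul_assoc]
    refine le_averagedNorm hD hK hα (by positivity) (by positivity) hGm inter_subset_left hGv ?_
    intro t ht
    have hδν : δ * ν ≤ ν := mul_le_of_le_one_left hν.le (min_le_left _ _)
    have hδT : δ * ν ≤ t := (mul_le_of_le_one_right hδ0.le hν1).trans
      ((min_le_right _ _).trans ht.1.1)
    have hlow : e / (2 * (T₂ - T₁)) ≤ g t := ht.2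
    refine le_trans (ENNReal.ofReal_le_ofReal ?_)
      (H ν hν hν1 u hu hi (δ * ν) (by positivity) hδν t hδT ?_)
    · gcongr ?_ * ?_
      exact Real.rpow_le_rpow_of_nonpos (by positivity) hδν (neg_nonpos.2 (gammaExp_nonneg _ _))
    · rw [mul_div_mul_left _ _ hδ0.ne', div_le_iff₀ hν, mul_comm _ ν]
      exact hlow

theorem theorem4p1 (f : ℝ → ℝ) (hf : ContDiff ℝ ∞ f)
    (σ : ℝ) (hσ : 0 < σ) (hconv : ∀ x, σ ≤ iteratedDeriv 2 f x)
    (D : ℝ) (hD : 0 < D) :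
    -- a constant as used in the definition of the averaging interval exists
    (∃ K : ℝ, 0 < K ∧ IsH1Constant f D K) ∧
    -- upper bounds, pointwise in time
    (∀ (m : ℕ) (p : ℝ≥0∞), (m ≤ 1 ∧ 1 ≤ p) ∨ (2 ≤ m ∧ 1 < p) →
      ∃ C : ℝ, 0 < C ∧
        ∀ ν : ℝ, 0 < ν → ν ≤ 1 → ∀ u : ℝ → ℝ → ℝ, IsBurgersSolution f ν u →
          initialParam (u 0) = ENNReal.ofReal D →
            ∀ t : ℝ, 0 < t → sobolevNorm m p (u t) ≤
              ENNReal.ofReal (C * max (ν ^ (-gammaExp m p)) (t ^ (-gammaExp m p)))) ∧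
    -- bounds for time averages, for every choice of that constant
    (∀ K : ℝ, 0 < K → IsH1Constant f D K →
      -- two-sided bounds
      (∀ (m : ℕ) (p : ℝ≥0∞), (m ≤ 1 ∧ 1 ≤ p) ∨ (2 ≤ m ∧ 1 < p) → ∀ α : ℝ, 0 < α →
        ∃ C : ℝ, 0 < C ∧
          ∀ ν : ℝ, 0 < ν → ν ≤ 1 → ∀ u : ℝ → ℝ → ℝ, IsBurgersSolution f ν u →
            initialParam (u 0) = ENNReal.ofReal D →
              ENNReal.ofReal (C⁻¹ * ν ^ (-gammaExp m p)) ≤ averagedNorm σ D K m p α u ∧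
              averagedNorm σ D K m p α u ≤ ENNReal.ofReal (C * ν ^ (-gammaExp m p))) ∧
      -- lower bounds without restriction on the indices
      (∀ (m : ℕ) (p : ℝ≥0∞), 1 ≤ p → ∀ α : ℝ, 0 < α →
        ∃ c : ℝ, 0 < c ∧
          ∀ ν : ℝ, 0 < ν → ν ≤ 1 → ∀ u : ℝ → ℝ → ℝ, IsBurgersSolution f ν u →
            initialParam (u 0) = ENNReal.ofReal D →
              ENNReal.ofReal (c * ν ^ (-gammaExp m p)) ≤ averagedNorm σ D K m p α u)) := by
  have hconv0 : ∀ x, 0 ≤ iteratedDeriv 2 f x := fun x => hσ.le.trans (hconv x)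
  refine ⟨exists_isH1Constant hf hconv0 hD, fun m p hmp => ?_, fun K hK hH1 =>
    ⟨fun m p hmp α hα => ?_, fun m p hp α hα =>
      exists_averagedNorm_lower_bound hf hσ hconv hD hK hH1 m p hp hα⟩⟩
  · obtain ⟨C, hC, H⟩ := exists_upper_bound hf hconv0 hD m p hmp
    refine ⟨C, hC, fun ν hν hν1 u hu hi t ht => ?_⟩
    -- The scale `h = min ν t` is the largest one admissible at time `t`.
    refine (H ν hν hν1 u hu hi (min ν t) (lt_min hν ht) (min_le_left _ _) t
      (min_le_right _ _)).trans (ENNReal.ofReal_le_ofReal ?_)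
    gcongr
    rcases min_choice ν t with h | h <;> rw [h]
    · exact le_max_left _ _
    · exact le_max_right _ _
  · have hp : 1 ≤ p := hmp.elim (fun h => h.2) (fun h => h.2.le)
    obtain ⟨c, hc, Hc⟩ := exists_averagedNorm_lower_bound hf hσ hconv hD hK hH1 m p hp hα
    obtain ⟨C, hC, HC⟩ := exists_upper_bound hf hconv0 hD m p hmp
    set δ := min 1 (timeOne D K) with hδ
    have hδ0 : 0 < δ := lt_min one_pos (timeOne_pos hD hK)
    set C' := C * δ ^ (-gammaExp m p) with hC'
    have hC'0 : 0 < C' := by positivity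
    refine ⟨max C' c⁻¹, lt_max_of_lt_left hC'0, fun ν hν hν1 u hu hi => ⟨?_, ?_⟩⟩
    · refine le_trans (ENNReal.ofReal_le_ofReal ?_) (Hc ν hν hν1 u hu hi)
      gcongr
      exact inv_le_of_inv_le₀ hc (le_max_right _ _)
    · refine averagedNorm_le hD hK hα fun t ht => ?_
      have hδν : δ * ν ≤ ν := mul_le_of_le_one_left hν.le (min_le_left _ _)
      have hδT : δ * ν ≤ t := (mul_le_of_le_one_right hδ0.le hν1).trans
        ((min_le_right _ _).trans ht.1)
      refine (HC ν hν hν1 u hu hi (δ * ν) (by positivity) hδν t hδT).trans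
        (ENNReal.ofReal_le_ofReal ?_)
      rw [Real.mul_rpow hδ0.le hν.le, ← mul_assoc]
      gcongr
      exact le_max_left _ _
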